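/- Let $N$ and $O$ be finite sets of agents and objects (write $|N|$ for the number of agents). Each object $j$ has a capacity $c_j\in\mathbb{Z}_{>0}$ and a minimum $m_j\in\mathbb{Z}_{\ge 0}$ with $m_j\le c_j$, $\sum_j c_j\ge |N|$ and $\sum_j m_j\le |N|$. Let $D$ be the set of matrices $M\in\{0,1\}^{N\times O}$ with $\sum_j M_{ij}=1$ for every agent $i$ (unit demand) and $m_j\le\sum_i M_{ij}\le c_j$ for every object $j$, and let $\Delta D=\mathrm{conv}(D)$ be the set of implementable random allocations. Each agent $i$ reports a strict ranking $\succ_i$ of $O$; for lotteries $x,y\in\mathbb{R}^O$ write $x\ge_i^{FOSD}y$ if $\sum_{j\succeq_i k}x_j\ge\sum_{j\succeq_i k}y_j$ for every $k\in O$. For $\mu\in\mathbb{R}_+^{N\times O}$ put $\mu_j=\sum_i\mu_{ij}$ and consider the inequalities $$\sum_j\mu_{ij}\le 1\ (i\in N),\qquad \mu_j\le c_j\ (j\in O),\qquad \sum_{j\in O\setminus S}\mu_j\le |N|-\sum_{j\in S}m_j\ \bigl(S\subseteq\{j:m_j>0\}\bigr).$$ Object $j$ is available at $\mu$ if none of the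 inequalities of the second and third group involving $\mu_j$ holds with equality. For a profile $\succ$, a run of the Minimums Probabilistic Serial (MPS) eating process is a continuous path $(\mu^t)_{t\in[0,1]}$ in $\mathbb{R}_+^{N\times O}$ with $\mu^0=0$, satisfying the inequalities at every time, such that at every $t\in[0,1)$ each agent $i$ eats at unit speed his favourite available object $k$: the right derivative of $\mu_{ij}$ at $t$ is $1$ for $j=k$ and $0$ for $j\ne k$, where $k$ is the $\succ_i$-best object among those available at $\mu^t$. Then for every profile $\succ$ there is a run, and all runs have the same final allocation $\mu^1=:f(\succ)$. The mechanism $f$ so defined (the MPS mechanism with unit demand) takes values in $\Delta D$ and is: - SD efficient: for no profile $\succ$ is there $\nu\in\Delta D$ with $\nu_i\ge_i^{FOSD}f_i(\succ)$ for all $i$ and $\nu_i\ne f_i(\succ)$ for some $i$; - anonymous: $f(\succ^\pi)=f(\succ)^\pi$ for every profile $\succ$ and every permutation $\pi$ of the agents; - envy free: $f_i(\succ)\ge_i^{FOSD}f_{i'}(\succ)$ for every profile $\succ$ and all agents $i,i'$; - weak strategyproof: for every profile $\succ$, agent $i$ and misreport $\succ_i'$, if $f_i(\succ_i',\succ_{-i})\ge_i^{FOSD}f_i(\succ_i,\succ_{-i})$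 then $f_i(\succ_i',\succ_{-i})=f_i(\succ_i,\succ_{-i})$. -/

import Mathlib

namespace MinProbSerial

/-- A strict preference ranking over the objects: `P.pref j k` means that `j` is strictly
preferred to `k`. -/
structure Ranking (O : Type*) where
  pref : O → O → Prop
  irrefl : ∀ j, ¬ pref j j
  trans : ∀ j k l, pref j k → pref k l → pref j l
  total : ∀ j k, j ≠ k → pref j k ∨ pref k j

/-- Total amount `μ_j = ∑ i, μ i j` of object `j` that is assigned. -/
def marginal {N O : Type*} [Fintype N] (μ : N → O → ℝ) (j : O) : ℝ := ∑ i, μ i j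

/-- The allowable deterministic allocations `D` (unit demand, capacities `c`, minimums `m`). -/
def allowable {N O : Type*} [Fintype N] [Fintype O] (c m : O → ℕ) : Set (N → O → ℝ) :=
  {M | (∀ i j, M i j = 0 ∨ M i j = 1) ∧ (∀ i, ∑ j, M i j = 1) ∧
    (∀ j, marginal M j ≤ c j) ∧ (∀ j, (m j : ℝ) ≤ marginal M j)}

/-- The implementable random allocations `ΔD = conv D`. -/
def implementable {N O : Type*} [Fintype N] [Fintype O] (c m : O → ℕ) : Set (N → O → ℝ) :=
  convexHull ℝ (allowable c m)

open Classical in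
/-- First order stochastic dominance (weak) of lotteries over the objects: for every object `k`,
`x` puts at least as much probability as `y` on the objects weakly preferred to `k`. -/
def FOSD {O : Type*} [Fintype O] (R : Ranking O) (x y : O → ℝ) : Prop :=
  ∀ k : O, ∑ j with (j = k ∨ R.pref j k), y j ≤ ∑ j with (j = k ∨ R.pref j k), x j

/-- Allowable sub-random allocations, by inequalities: nonnegativity, relaxed unit demand,
capacities, and the minimum inequalities
`∑_{j ∉ S} μ_j ≤ |N| - ∑_{j ∈ S} m_j` for all sets `S` of objects with positive minimum. -/
structure SubAllocation {N O : Type*} [Fintype N] [Fintype O] [DecidableEq O]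
    (c m : O → ℕ) (μ : N → O → ℝ) : Prop where
  nonneg : ∀ i j, 0 ≤ μ i j
  demand : ∀ i, ∑ j, μ i j ≤ 1
  cap : ∀ j, marginal μ j ≤ c j
  min : ∀ S : Finset O, (∀ j ∈ S, 0 < m j) →
    ∑ j ∈ Sᶜ, marginal μ j ≤ (Fintype.card N : ℝ) - ∑ j ∈ S, (m j : ℝ)

/-- Object `j` is available at `μ`: no capacity or minimum inequality involving `μ_j` binds. -/
def Available {N O : Type*} [Fintype N] [Fintype O] [DecidableEq O]
    (c m : O → ℕ) (μ : N → O → ℝ) (j : O) : Prop :=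
  marginal μ j ≠ c j ∧
  ∀ S : Finset O, (∀ k ∈ S, 0 < m k) → j ∈ Sᶜ →
    ∑ k ∈ Sᶜ, marginal μ k ≠ (Fintype.card N : ℝ) - ∑ k ∈ S, (m k : ℝ)

/-- `j` is the favourite object among those available at `μ`, according to `R`. -/
def IsFavorite {N O : Type*} [Fintype N] [Fintype O] [DecidableEq O]
    (c m : O → ℕ) (R : Ranking O) (μ : N → O → ℝ) (j : O) : Prop :=
  Available c m μ j ∧ ∀ k, Available c m μ k → k ≠ j → R.pref j k

/-- `μ` (restricted to times in `[0,1]`) is a run of the continuous-time eating process at the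
reported profile `P`: it starts at zero, moves continuously through allowable sub-random
allocations, and at each time `t < 1` every agent eats, at unit speed, his favourite object among
those available at `t`, and eats nothing else. -/
structure IsRun {N O : Type*} [Fintype N] [Fintype O] [DecidableEq O]
    (c m : O → ℕ) (P : N → Ranking O) (μ : ℝ → N → O → ℝ) : Prop where
  init : μ 0 = 0
  cont : ContinuousOn μ (Set.Icc 0 1)
  sub : ∀ t ∈ Set.Icc (0 : ℝ) 1, SubAllocation c m (μ t)
  eats : ∀ t ∈ Set.Ico (0 : ℝ) 1, ∀ i, ∃ k, IsFavorite c m (P i) (μ t) k ∧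
    HasDerivWithinAt (fun s => μ s i k) 1 (Set.Ici t) t ∧
    ∀ j, j ≠ k → HasDerivWithinAt (fun s => μ s i j) 0 (Set.Ici t) t

/-- `f` is the Minimums Probabilistic Serial mechanism: it maps each profile to the allocation
reached at time `1` by a run of the eating process. -/
def IsMPS {N O : Type*} [Fintype N] [Fintype O] [DecidableEq O]
    (c m : O → ℕ) (f : (N → Ranking O) → N → O → ℝ) : Prop :=
  ∀ P, ∃ μ : ℝ → N → O → ℝ, IsRun c m P μ ∧ μ 1 = f P

/-- `f` always selects implementable random allocations. -/
def IsMechanism {N O : Type*} [Fintype N] [Fintype O]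
    (c m : O → ℕ) (f : (N → Ranking O) → N → O → ℝ) : Prop :=
  ∀ P, f P ∈ implementable c m

/-- No implementable random allocation weakly dominates `f P` for all agents and strictly
dominates it for at least one agent. -/
def SDEfficient {N O : Type*} [Fintype N] [Fintype O]
    (c m : O → ℕ) (f : (N → Ranking O) → N → O → ℝ) : Prop :=
  ∀ P, ¬ ∃ ν ∈ implementable c m, (∀ i, FOSD (P i) (ν i) (f P i)) ∧
    ∃ i, FOSD (P i) (ν i) (f P i) ∧ ν i ≠ f P i

/-- Re-indexing the agents re-indexes their lotteries in the same way. -/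
def Anonymous {N O : Type*} (f : (N → Ranking O) → N → O → ℝ) : Prop :=
  ∀ (P : N → Ranking O) (π : Equiv.Perm N), f (fun i => P (π i)) = fun i => f P (π i)

/-- No agent fails to weakly prefer his own lottery to that of another agent. -/
def EnvyFree {N O : Type*} [Fintype O] (f : (N → Ranking O) → N → O → ℝ) : Prop :=
  ∀ P i i', FOSD (P i) (f P i) (f P i')

/-- A misreport whose lottery weakly dominates the truthful one yields the same lottery. -/
def WeakStrategyproof {N O : Type*} [DecidableEq N] [Fintype O]
    (f : (N → Ranking O) → N → O → ℝ) : Prop :=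
  ∀ (P : N → Ranking O) (i : N) (R' : Ranking O),
    FOSD (P i) (f (Function.update P i R') i) (f P i) →
      f (Function.update P i R') i = f P i

end MinProbSerial

/-! Since `μ_j ≥ 0`, the minimum inequalities, one for each set `S`, say together that the surplus
`∑ max (μ_j - m_j) 0` is at most the slack `|N| - ∑ m_j`. Availability of `j` then means: capacity
is left, and either the surplus is not used up or `j` is below its minimum (`available_iff_open`).
This condition only gets harder as loads grow, so each object is available exactly up to an
exhaustion time `T j`. An agent eats `j` from the moment everything he prefers is exhausted until `T
j`, so `T` determines the whole run through the explicit formula `eaten`.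

Existence follows by eating linearly until the next exhaustion; uniqueness, because two schedules
cannot have a first time of disagreement (`IsSchedule.coincide`). At time 1 the total is `|N|`,
which forces all minimums to be met. The final allocation thus lies in the polytope `feasible`,
which equals the convex hull by Birkhoff's theorem.

Efficiency: at the earliest exhausted object where a dominating allocation differs, that allocation
gives every agent at least as much, and someone more, of an object stopped by its capacity or by the
surplus bound, which is infeasible. Envy-freeness: everyone faces the same available set. Anonymity:
uniqueness.

Weak strategyproofness is the hard part. Let `τ` be the infimum of the times when the truthful and
the misreported meals differ, and `a` the true meal at `τ`. Dominance forces at least as much of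
`a`, eaten from a later start, so `a` lasts longer under the lie. Every object exhausted before `a`
is then exhausted no later under the lie (`Deviation.exhausted_earlier`), so other consumers of a
longer-lasting object gain strictly. Capacity or surplus accounting leaves no room for such gains,
so the manipulator is the only consumer of these objects, and what he eats of them is an integer
combination of the data. Yet it lies strictly between 0 and 1 (`Deviation.not_integer`). -/

namespace MinProbSerial

/-! ### The minimum inequalities as a single surplus bound -/

/-- Total amount by which the loads `x` exceed the minimums `m`. -/
def surplus {O : Type*} [Fintype O] (m : O → ℕ) (x : O → ℝ) : ℝ := ∑ j, max (x j - m j) 0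

/-- Number of agents not needed to fill the minimums. -/
def slack (N : Type*) {O : Type*} [Fintype N] [Fintype O] (m : O → ℕ) : ℝ :=
  (Fintype.card N : ℝ) - ∑ j, (m j : ℝ)

/-- Closed form of availability: there is capacity left, and either the total surplus is not yet
exhausted or the minimum of `j` is not yet reached. -/
def Open (N : Type*) {O : Type*} [Fintype N] [Fintype O] (c m : O → ℕ) (x : O → ℝ) (j : O) :
    Prop :=
  x j < c j ∧ (surplus m x < slack N m ∨ x j < m j)

section Basic

variable {N O : Type*} [Fintype N] [Fintype O]

theorem surplus_mono (m : O → ℕ) {x y : O → ℝ} (h : ∀ j, x j ≤ y j) :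
    surplus m x ≤ surplus m y :=
  Finset.sum_le_sum fun j _ => max_le_max (sub_le_sub_right (h j) _) le_rfl

theorem sum_sub_le_surplus (m : O → ℕ) (x : O → ℝ) (A : Finset O) :
    ∑ j ∈ A, (x j - m j) ≤ surplus m x :=
  (Finset.sum_le_sum fun _ _ => le_max_left _ _).trans
    (Finset.sum_le_sum_of_subset_of_nonneg (Finset.subset_univ A) fun _ _ _ => le_max_right _ _)

theorem sum_sub_eq_surplus (m : O → ℕ) (x : O → ℝ) (A : Finset O)
    (h : ∀ j ∈ A, (m j : ℝ) ≤ x j) (h' : ∀ j ∉ A, x j ≤ m j) :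
    ∑ j ∈ A, (x j - m j) = surplus m x := by
  unfold surplus
  rw [← Finset.sum_subset (Finset.subset_univ A)]
  · exact Finset.sum_congr rfl fun j hj => (max_eq_left (sub_nonneg.2 (h j hj))).symm
  · intro j _ hj
    exact max_eq_right (sub_nonpos.2 (h' j hj))

theorem sum_sub_lt_surplus (m : O → ℕ) (x : O → ℝ) {A : Finset O} {j : O} (hj : j ∈ A)
    (h : x j < m j) : ∑ k ∈ A, (x k - m k) < surplus m x := by
  refine lt_of_lt_of_le (Finset.sum_lt_sum (fun _ _ => le_max_left _ 0) ⟨j, hj, ?_⟩)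
    (Finset.sum_le_sum_of_subset_of_nonneg (Finset.subset_univ A) fun _ _ _ => le_max_right _ _)
  exact lt_max_of_lt_right (sub_neg.2 h)

theorem Open.of_le {c m : O → ℕ} {x y : O → ℝ} {j : O} (h : Open N c m y j)
    (hxy : ∀ k, x k ≤ y k) : Open N c m x j :=
  ⟨(hxy j).trans_lt h.1, h.2.imp (surplus_mono m hxy).trans_lt (hxy j).trans_lt⟩

theorem le_of_not_open {c m : O → ℕ} (hmc : ∀ j, m j ≤ c j) {x : O → ℝ} {j : O}
    (h : ¬ Open N c m x j) : (m j : ℝ) ≤ x j := by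
  by_contra! hlt
  exact h ⟨hlt.trans_le (Nat.cast_le.2 (hmc j)), Or.inr hlt⟩

theorem le_or_of_not_open {c m : O → ℕ} {x : O → ℝ} {j : O} (h : ¬ Open N c m x j) :
    (c j : ℝ) ≤ x j ∨ slack N m ≤ surplus m x ∧ (m j : ℝ) ≤ x j := by
  by_contra! hcon
  by_cases hs : slack N m ≤ surplus m x
  · exact h ⟨hcon.1, Or.inr (hcon.2 hs)⟩
  · exact h ⟨hcon.1, Or.inl (not_le.1 hs)⟩

theorem sum_sub_eq (x : O → ℝ) (m : O → ℕ) :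
    ∑ j, (x j - m j) = ∑ j, x j - Fintype.card N + slack N m := by
  simp only [slack, Finset.sum_sub_distrib]; ring

theorem slack_le_surplus_of_total {x : O → ℝ} {m : O → ℕ} (h : ∑ j, x j = Fintype.card N) :
    slack N m ≤ surplus m x := by
  have h1 := sum_sub_le_surplus m x Finset.univ
  rw [sum_sub_eq (N := N), h] at h1
  linarith

theorem min_le_of_total {x : O → ℝ} {m : O → ℕ} (h : ∑ j, x j = Fintype.card N)
    (hs : surplus m x ≤ slack N m) (j : O) : (m j : ℝ) ≤ x j := by
  by_contra! hlt
  have h1 := sum_sub_lt_surplus m x (Finset.mem_univ j) hlt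
  rw [sum_sub_eq (N := N), h] at h1
  linarith

/-- When the total is `|N|`, the signed excesses over the minimums sum to the slack. A surplus
within the slack therefore leaves no negative excess: the surplus is used up and every minimum is
met. -/
theorem not_open_of_total {x : O → ℝ} {c m : O → ℕ} (h : ∑ j, x j = Fintype.card N)
    (hs : surplus m x ≤ slack N m) (j : O) : ¬ Open N c m x j := by
  rintro ⟨-, h1 | h1⟩
  · exact h1.not_ge (slack_le_surplus_of_total h)
  · exact h1.not_ge (min_le_of_total h hs j)

/-- If everything were closed, either the surplus is used up and all minimums are met, so the total
is at least `|N|`, or every object is at capacity and `hcap` gives the same bound. -/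
theorem exists_open_of_total_lt {c m : O → ℕ} (hmc : ∀ j, m j ≤ c j)
    (hcap : Fintype.card N ≤ ∑ j, c j) {x : O → ℝ} (h : ∑ j, x j < Fintype.card N) :
    ∃ j, Open N c m x j := by
  by_contra! hno
  by_cases hs : slack N m ≤ surplus m x
  · have h1 := sum_sub_eq_surplus m x Finset.univ (fun j _ => le_of_not_open hmc (hno j))
      (fun j hj => absurd (Finset.mem_univ j) hj)
    rw [sum_sub_eq (N := N)] at h1
    linarith
  · have h1 : ∀ j, (c j : ℝ) ≤ x j := fun j =>
      (le_or_of_not_open (hno j)).resolve_right fun h2 => hs h2.1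
    have h2 : (Fintype.card N : ℝ) ≤ ∑ j, (c j : ℝ) := by exact_mod_cast hcap
    have h3 := Finset.sum_le_sum fun j (_ : j ∈ Finset.univ) => h1 j
    linarith

variable [DecidableEq O]

theorem sum_compl_eq (x : O → ℝ) (m : O → ℕ) (S : Finset O) :
    ∑ j ∈ Sᶜ, x j - ((Fintype.card N : ℝ) - ∑ j ∈ S, (m j : ℝ)) =
      ∑ j ∈ Sᶜ, (x j - m j) - slack N m := by
  rw [slack, Finset.sum_sub_distrib, ← Finset.sum_add_sum_compl S (fun j => (m j : ℝ))]
  ring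

theorem surplus_le_slack {c m : O → ℕ} {μ : N → O → ℝ} (h : SubAllocation c m μ) :
    surplus m (marginal μ) ≤ slack N m := by
  classical
  have h0 : ∀ j, 0 ≤ marginal μ j := fun j => Finset.sum_nonneg fun i _ => h.nonneg i j
  -- The tightest inequality drops exactly the objects with nonpositive excess. Those with `m j = 0`
  -- may not enter `S`, but their excess is nonnegative anyway.
  set S : Finset O := Finset.univ.filter fun j => 0 < m j ∧ marginal μ j ≤ m j with hS
  have h1 := h.min S (fun j hj => (Finset.mem_filter.1 hj).2.1)
  have h2 := sum_compl_eq (N := N) (marginal μ) m S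
  rw [sum_sub_eq_surplus] at h2
  · linarith
  · intro j hj
    simp only [hS, Finset.mem_compl, Finset.mem_filter, Finset.mem_univ, true_and, not_and,
      not_le] at hj
    rcases Nat.eq_zero_or_pos (m j) with hm | hm
    · simpa [hm] using h0 j
    · exact (hj hm).le
  · intro j hj
    simp only [hS, Finset.mem_compl, not_not, Finset.mem_filter] at hj
    exact hj.2.2

theorem subAllocation_of_surplus_le {c m : O → ℕ} {μ : N → O → ℝ} (h0 : ∀ i j, 0 ≤ μ i j)
    (h1 : ∀ i, ∑ j, μ i j ≤ 1) (hc : ∀ j, marginal μ j ≤ c j)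
    (hs : surplus m (marginal μ) ≤ slack N m) : SubAllocation c m μ := by
  refine ⟨h0, h1, hc, fun S _ => ?_⟩
  have h2 := sum_compl_eq (N := N) (marginal μ) m S
  have h3 := sum_sub_le_surplus m (marginal μ) Sᶜ
  linarith

/-- A binding inequality whose complement contains `j` has excess sum equal to the full surplus.
This is impossible if `j` is below its minimum, since dropping `j` would increase the sum; otherwise
the set of objects below their minimum witnesses it. -/
theorem available_iff_open {c m : O → ℕ} {μ : N → O → ℝ} (h : SubAllocation c m μ) (j : O) :
    Available c m μ j ↔ Open N c m (marginal μ) j := by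
  classical
  have hs := surplus_le_slack h
  have h0 : ∀ j, 0 ≤ marginal μ j := fun j => Finset.sum_nonneg fun i _ => h.nonneg i j
  constructor
  · rintro ⟨h1, h2⟩
    refine ⟨lt_of_le_of_ne (h.cap j) h1, ?_⟩
    by_contra! hcon
    set S : Finset O := Finset.univ.filter fun j => marginal μ j < m j with hS
    refine h2 S (fun k hk => ?_) ?_ ?_
    · have := (Finset.mem_filter.1 hk).2
      exact_mod_cast (h0 k).trans_lt this
    · simpa [hS] using hcon.2
    · have h3 := sum_compl_eq (N := N) (marginal μ) m S
      rw [sum_sub_eq_surplus] at h3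
      · linarith [hcon.1]
      · intro j hj
        simpa [hS] using hj
      · intro j hj
        simp only [hS, Finset.mem_compl, not_not, Finset.mem_filter] at hj
        exact hj.2.le
  · rintro ⟨h1, h2⟩
    refine ⟨h1.ne, fun S _ hj heq => ?_⟩
    have h3 := sum_compl_eq (N := N) (marginal μ) m S
    rcases h2 with h2 | h2
    · have h4 := sum_sub_le_surplus m (marginal μ) Sᶜ
      linarith
    · have h4 := sum_sub_lt_surplus m (marginal μ) hj h2
      linarith

end Basic

/-! ### Consumption determined by exhaustion times -/

/-- Agents with ranking `R` eat `j` at time `t`, if `T` lists the times at which the objects are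
exhausted. -/
def Eats {O : Type*} (R : Ranking O) (T : O → ℝ) (t : ℝ) (j : O) : Prop :=
  t < T j ∧ ∀ k, R.pref k j → T k ≤ t

theorem Eats.unique {O : Type*} {R : Ranking O} {T : O → ℝ} {t : ℝ} {j k : O}
    (hj : Eats R T t j) (hk : Eats R T t k) : j = k := by
  by_contra hne
  rcases R.total j k hne with h | h
  · exact (hk.2 j h).not_gt hj.1
  · exact (hj.2 k h).not_gt hk.1

open Classical in
/-- The time from which all objects preferred to `j` are exhausted. -/
noncomputable def start {O : Type*} [Fintype O] (R : Ranking O) (T : O → ℝ) (j : O) : ℝ :=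
  (insert 0 ((Finset.univ.filter fun k => R.pref k j).image T)).max' (Finset.insert_nonempty _ _)

/-- The amount of `j` that an agent with ranking `R` eats up to time `t`. -/
noncomputable def eaten {O : Type*} [Fintype O] (R : Ranking O) (T : O → ℝ) (t : ℝ) (j : O) : ℝ :=
  max 0 (min (T j) t - start R T j)

section Eaten

variable {O : Type*} [Fintype O] {R R' : Ranking O} {T T' : O → ℝ} {t u : ℝ} {j : O}

theorem start_le_iff : start R T j ≤ u ↔ 0 ≤ u ∧ ∀ k, R.pref k j → T k ≤ u := by
  classical
  simp [start, Finset.max'_le_iff]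

theorem start_nonneg : 0 ≤ start R T j := (start_le_iff.1 le_rfl).1

theorem eats_iff (ht : 0 ≤ t) : Eats R T t j ↔ start R T j ≤ t ∧ t < T j := by
  rw [start_le_iff, Eats]; tauto

theorem eaten_nonneg : 0 ≤ eaten R T t j := le_max_left _ _

theorem eaten_mono (h : t ≤ u) : eaten R T t j ≤ eaten R T u j :=
  max_le_max le_rfl (sub_le_sub_right (min_le_min le_rfl h) _)

theorem eaten_eq_of_le (h : T j ≤ t) (h' : T j ≤ u) : eaten R T t j = eaten R T u j := by
  simp [eaten, min_eq_left h, min_eq_left h']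

theorem continuous_eaten (R : Ranking O) (T : O → ℝ) (j : O) :
    Continuous fun t => eaten R T t j := by
  unfold eaten; fun_prop

/-- The times at which `j` is eaten form an interval, so pointwise inclusion up to `u` compares the
amounts. The hypothesis is needed only at the two critical times `start R T j` and `T' j`. This is
the basic tool for comparing schedules. -/
theorem eaten_le_eaten (h : ∀ t, 0 ≤ t → t < u → Eats R T t j → Eats R' T' t j) :
    eaten R T u j ≤ eaten R' T' u j := by
  rcases le_or_gt (min (T j) u) (start R T j) with hs | hs
  · rw [eaten, max_eq_left (sub_nonpos.2 hs)]
    exact eaten_nonneg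
  have h0 : 0 ≤ start R T j := start_nonneg
  obtain ⟨hT, hu⟩ := lt_min_iff.1 hs
  have h1 := (eats_iff h0).1 (h _ h0 hu ((eats_iff h0).2 ⟨le_rfl, hT⟩))
  have h2 : min (T j) u ≤ T' j := by
    by_contra! hlt
    obtain ⟨h3, h4⟩ := lt_min_iff.1 hlt
    have h5 : 0 ≤ T' j := h0.trans h1.2.le
    exact lt_irrefl _ (h _ h5 h4 ((eats_iff h5).2 ⟨h1.2.le, h3⟩)).1
  exact max_le_max le_rfl (sub_le_sub (le_min h2 (min_le_right _ _)) h1.1)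

theorem eaten_congr (h : ∀ t, 0 ≤ t → t < u → (Eats R T t j ↔ Eats R' T' t j)) :
    eaten R T u j = eaten R' T' u j :=
  le_antisymm (eaten_le_eaten fun t h0 h1 => (h t h0 h1).1)
    (eaten_le_eaten fun t h0 h1 => (h t h0 h1).2)

theorem eaten_pos_iff : 0 < eaten R T t j ↔ start R T j < T j ∧ start R T j < t := by
  simp [eaten]

theorem hasDerivWithinAt_eaten_of_eats (ht : 0 ≤ t) (h : Eats R T t j) :
    HasDerivWithinAt (fun u => eaten R T u j) 1 (Set.Ici t) t := by
  obtain ⟨h1, h2⟩ := (eats_iff ht).1 h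
  have h3 : HasDerivWithinAt (fun u => u - start R T j) 1 (Set.Ici t) t :=
    ((hasDerivAt_id t).sub_const _).hasDerivWithinAt
  refine h3.congr_of_eventuallyEq_of_mem ?_ Set.self_mem_Ici
  filter_upwards [Ico_mem_nhdsGE h2] with u hu
  rw [eaten, min_eq_right hu.2.le, max_eq_right (sub_nonneg.2 (h1.trans hu.1))]

theorem hasDerivWithinAt_eaten_of_not_eats (ht : 0 ≤ t) (h : ¬ Eats R T t j) :
    HasDerivWithinAt (fun u => eaten R T u j) 0 (Set.Ici t) t := by
  rw [eats_iff ht, not_and_or, not_le, not_lt] at h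
  rcases h with h | h
  · refine (hasDerivWithinAt_const t _ (0 : ℝ)).congr_of_eventuallyEq_of_mem ?_ Set.self_mem_Ici
    filter_upwards [Ico_mem_nhdsGE h] with u hu
    exact max_eq_left (sub_nonpos.2 ((min_le_right _ _).trans hu.2.le))
  · refine (hasDerivWithinAt_const t _ (eaten R T t j)).congr_of_eventuallyEq_of_mem ?_
      Set.self_mem_Ici
    filter_upwards [self_mem_nhdsWithin] with u hu
    exact eaten_eq_of_le (h.trans hu) h

end Eaten

/-! ### Schedules, and the schedule of a run -/

/-- Total amount of `j` eaten by all agents up to time `t`. -/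
noncomputable def load {N O : Type*} [Fintype N] [Fintype O] (P : N → Ranking O) (T : O → ℝ)
    (t : ℝ) (j : O) : ℝ := ∑ i, eaten (P i) T t j

/-- The exhaustion times `T` are consistent with the eating process they define. -/
structure IsSchedule {N O : Type*} [Fintype N] [Fintype O] (c m : O → ℕ) (P : N → Ranking O)
    (T : O → ℝ) : Prop where
  nonneg : ∀ j, 0 ≤ T j
  le_one : ∀ j, T j ≤ 1
  load_le : ∀ t ∈ Set.Icc (0 : ℝ) 1, ∀ j, load P T t j ≤ c j
  surplus_le : ∀ t ∈ Set.Icc (0 : ℝ) 1, surplus m (load P T t) ≤ slack N m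
  open_iff : ∀ t ∈ Set.Icc (0 : ℝ) 1, ∀ j, Open N c m (load P T t) j ↔ t < T j
  exists_eats : ∀ t ∈ Set.Ico (0 : ℝ) 1, ∀ i, ∃ j, Eats (P i) T t j
  sum_eaten : ∀ t ∈ Set.Icc (0 : ℝ) 1, ∀ i, ∑ j, eaten (P i) T t j = t

theorem continuous_surplus {O : Type*} [Fintype O] (m : O → ℕ) : Continuous (surplus m) := by
  unfold surplus; fun_prop

theorem isClosed_not_open {N O : Type*} [Fintype N] [Fintype O] (c m : O → ℕ) (j : O) :
    IsClosed {x : O → ℝ | ¬ Open N c m x j} := by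
  have h : IsOpen {x : O → ℝ | Open N c m x j} := by
    have h1 : IsOpen {x : O → ℝ | x j < c j} := isOpen_lt (by fun_prop) (by fun_prop)
    have h2 : IsOpen {x : O → ℝ | surplus m x < slack N m} :=
      isOpen_lt (continuous_surplus m) (by fun_prop)
    have h3 : IsOpen {x : O → ℝ | x j < m j} := isOpen_lt (by fun_prop) (by fun_prop)
    exact h1.inter (h2.union h3)
  exact h.isClosed_compl

section Run

variable {N O : Type*} [Fintype N] [Fintype O] [DecidableEq O] {c m : O → ℕ} {P : N → Ranking O}
  {μ : ℝ → N → O → ℝ}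

theorem IsRun.continuousOn_apply (h : IsRun c m P μ) (i : N) (j : O) :
    ContinuousOn (fun t => μ t i j) (Set.Icc 0 1) :=
  continuousOn_pi.1 (continuousOn_pi.1 h.cont i) j

theorem IsRun.monotoneOn (h : IsRun c m P μ) (i : N) (j : O) :
    MonotoneOn (fun t => μ t i j) (Set.Icc 0 1) := by
  intro a ha b hb hab
  have hsub : Set.Icc a b ⊆ Set.Icc 0 1 := Set.Icc_subset_Icc ha.1 hb.2
  have hd : ∀ t ∈ Set.Ico (0 : ℝ) 1, ∃ d : ℝ, 0 ≤ d ∧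
      HasDerivWithinAt (fun s => μ s i j) d (Set.Ici t) t := by
    intro t ht
    obtain ⟨k, -, h1, h2⟩ := h.eats t ht i
    by_cases hjk : j = k
    · exact ⟨1, zero_le_one, hjk ▸ h1⟩
    · exact ⟨0, le_rfl, h2 j hjk⟩
  choose! d hd0 hd1 using hd
  have hIco : ∀ t ∈ Set.Ico a b, t ∈ Set.Ico (0 : ℝ) 1 := fun t ht =>
    ⟨ha.1.trans ht.1, ht.2.trans_le hb.2⟩
  exact image_le_of_deriv_right_le_deriv_boundary (f := fun _ => μ a i j) (f' := fun _ => 0)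
    continuousOn_const (fun t _ => hasDerivWithinAt_const t _ _) le_rfl
    ((h.continuousOn_apply i j).mono hsub) (fun t ht => hd1 t (hIco t ht))
    (fun t ht => hd0 t (hIco t ht)) (Set.right_mem_Icc.2 hab)

theorem IsRun.sum_eq (h : IsRun c m P μ) (i : N) :
    ∀ t ∈ Set.Icc (0 : ℝ) 1, ∑ j, μ t i j = t := by
  refine eq_of_has_deriv_right_eq (f' := fun _ => 1) (fun t ht => ?_)
    (fun t _ => (hasDerivAt_id t).hasDerivWithinAt)
    (continuousOn_finsetSum _ fun j _ => h.continuousOn_apply i j) continuousOn_id ?_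
  · obtain ⟨k, -, h1, h2⟩ := h.eats t ht i
    have h3 : ∀ j ∈ Finset.univ, HasDerivWithinAt (fun s => μ s i j) (if j = k then 1 else 0)
        (Set.Ici t) t := by
      intro j _
      split_ifs with hjk
      · exact hjk ▸ h1
      · exact h2 j hjk
    simpa using HasDerivWithinAt.fun_sum h3
  · simp [h.init]

theorem IsRun.total_eq (h : IsRun c m P μ) {t : ℝ} (ht : t ∈ Set.Icc (0 : ℝ) 1) :
    ∑ j, marginal (μ t) j = Fintype.card N * t := by
  simp only [marginal]
  rw [Finset.sum_comm, Finset.sum_congr rfl fun i _ => h.sum_eq i t ht]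
  simp

/-- `T j` is the first time `j` is closed: it exists because everything is closed at time 1 and
closedness is a closed condition, and `j` stays closed because loads grow. The run and `eaten` then
share initial value and right derivatives, hence agree. -/
theorem IsRun.exists_isSchedule (h : IsRun c m P μ) :
    ∃ T, IsSchedule c m P T ∧
      ∀ t ∈ Set.Icc (0 : ℝ) 1, ∀ i j, μ t i j = eaten (P i) T t j := by
  have hmarg : ContinuousOn (fun t => marginal (μ t)) (Set.Icc 0 1) :=
    continuousOn_pi.2 fun j => continuousOn_finsetSum _ fun i _ => h.continuousOn_apply i j
  have hmono : ∀ a ∈ Set.Icc (0 : ℝ) 1, ∀ b ∈ Set.Icc (0 : ℝ) 1, a ≤ b → ∀ j,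
      marginal (μ a) j ≤ marginal (μ b) j := fun a ha b hb hab j =>
    Finset.sum_le_sum fun i _ => h.monotoneOn i j ha hb hab
  have hend : ∀ j, ¬ Open N c m (marginal (μ 1)) j := by
    have h1 : (1 : ℝ) ∈ Set.Icc (0 : ℝ) 1 := by simp
    exact not_open_of_total (by simpa using h.total_eq h1) (surplus_le_slack (h.sub 1 h1))
  let Z : O → Set ℝ := fun j => {t | t ∈ Set.Icc (0 : ℝ) 1 ∧ ¬ Open N c m (marginal (μ t)) j}
  have hZ : ∀ j, IsClosed (Z j) := fun j =>
    hmarg.preimage_isClosed_of_isClosed isClosed_Icc (isClosed_not_open c m j)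
  have hZ1 : ∀ j, (1 : ℝ) ∈ Z j := fun j => ⟨by simp, hend j⟩
  have hZb : ∀ j, BddBelow (Z j) := fun j => ⟨0, fun t ht => ht.1.1⟩
  have hT : ∀ j, sInf (Z j) ∈ Z j := fun j => (hZ j).csInf_mem ⟨1, hZ1 j⟩ (hZb j)
  set T : O → ℝ := fun j => sInf (Z j) with hTdef
  have hopen : ∀ t ∈ Set.Icc (0 : ℝ) 1, ∀ j, Open N c m (marginal (μ t)) j ↔ t < T j := by
    intro t ht j
    constructor
    · intro ho
      by_contra! hle
      exact (hT j).2 (ho.of_le (hmono _ (hT j).1 _ ht hle))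
    · intro hlt
      by_contra hno
      exact (csInf_le (hZb j) ⟨ht, hno⟩).not_gt hlt
  have hfav : ∀ t ∈ Set.Ico (0 : ℝ) 1, ∀ i, ∃ k, Eats (P i) T t k ∧
      HasDerivWithinAt (fun s => μ s i k) 1 (Set.Ici t) t ∧
      ∀ j, j ≠ k → HasDerivWithinAt (fun s => μ s i j) 0 (Set.Ici t) t := by
    intro t ht i
    obtain ⟨k, hk, hd⟩ := h.eats t ht i
    have ht' := Set.Ico_subset_Icc_self ht
    refine ⟨k, ⟨?_, fun l hl => ?_⟩, hd⟩
    · rw [← hopen t ht', ← available_iff_open (h.sub t ht')]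
      exact hk.1
    · by_contra! hlt
      rw [← hopen t ht', ← available_iff_open (h.sub t ht')] at hlt
      have hne : l ≠ k := fun e => (P i).irrefl k (e ▸ hl)
      exact (P i).irrefl k ((P i).trans _ _ _ (hk.2 l hlt hne) hl)
  have heq : ∀ t ∈ Set.Icc (0 : ℝ) 1, ∀ i j, μ t i j = eaten (P i) T t j := by
    classical
    intro t ht i j
    refine eq_of_has_deriv_right_eq (f := fun t => μ t i j) (g := fun t => eaten (P i) T t j)
      (f' := fun t => if Eats (P i) T t j then 1 else 0) (fun s hs => ?_) (fun s hs => ?_)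
      (h.continuousOn_apply i j) (continuous_eaten _ _ _).continuousOn ?_ t ht
    · obtain ⟨k, hk, h1, h2⟩ := hfav s hs i
      split_ifs with hj
      · exact hj.unique hk ▸ h1
      · exact h2 j fun e => hj (e ▸ hk)
    · split_ifs with hj
      · exact hasDerivWithinAt_eaten_of_eats hs.1 hj
      · exact hasDerivWithinAt_eaten_of_not_eats hs.1 hj
    · have h0 : start (P i) T j ≥ 0 := start_nonneg
      have h1 : min (T j) 0 ≤ 0 := min_le_right _ _
      simp only [h.init, Pi.zero_apply, eaten]
      rw [max_eq_left]
      linarith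
  have hload : ∀ t ∈ Set.Icc (0 : ℝ) 1, load P T t = marginal (μ t) := by
    intro t ht
    funext j
    exact Finset.sum_congr rfl fun i _ => (heq t ht i j).symm
  refine ⟨T, ⟨fun j => (hT j).1.1, fun j => (hT j).1.2, fun t ht => ?_, fun t ht => ?_,
    fun t ht => ?_, fun t ht i => ?_, fun t ht i => ?_⟩, heq⟩
  · rw [hload t ht]; exact (h.sub t ht).cap
  · rw [hload t ht]; exact surplus_le_slack (h.sub t ht)
  · rw [hload t ht]; exact hopen t ht
  · obtain ⟨k, hk, -⟩ := hfav t ht i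
    exact ⟨k, hk⟩
  · exact (Finset.sum_congr rfl fun j _ => (heq t ht i j).symm).trans (h.sum_eq i t ht)

end Run

theorem Eats.congr {O : Type*} {R : Ranking O} {T T' : O → ℝ} {t : ℝ}
    (h : ∀ k, t < T k ↔ t < T' k) (j : O) :
    Eats R T t j ↔ Eats R T' t j := by
  unfold Eats
  rw [h j]
  refine and_congr_right fun _ => forall₂_congr fun k _ => ?_
  rw [← not_lt, h k, not_lt]

/-! ### Comparison of schedules and uniqueness of the outcome -/

section Schedule

variable {N O : Type*} [Fintype N] [Fintype O] {c m : O → ℕ} {P P' : N → Ranking O}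
  {T T' : O → ℝ}

theorem load_mono (P : N → Ranking O) (T : O → ℝ) {t u : ℝ} (h : t ≤ u) (j : O) :
    load P T t j ≤ load P T u j :=
  Finset.sum_le_sum fun _ _ => eaten_mono h

theorem load_eq_of_le (P : N → Ranking O) {t u : ℝ} {j : O} (h : T j ≤ t) (h' : T j ≤ u) :
    load P T t j = load P T u j :=
  Finset.sum_congr rfl fun _ _ => eaten_eq_of_le h h'

theorem IsSchedule.not_open (h : IsSchedule c m P T) (j : O) :
    ¬ Open N c m (load P T (T j)) j := by
  rw [h.open_iff _ ⟨h.nonneg j, h.le_one j⟩]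
  exact lt_irrefl _

theorem IsSchedule.not_open_of_le (h : IsSchedule c m P T) {j : O} {t : ℝ} (hj : T j ≤ t)
    (ht : t ∈ Set.Icc (0 : ℝ) 1) : ¬ Open N c m (load P T t) j := by
  rw [h.open_iff _ ht]
  exact hj.not_gt

/-- If the surplus is used up at time `t`, it has been spent on the objects exhausted by then. -/
theorem IsSchedule.sum_sub_eq_slack (h : IsSchedule c m P T) (hmc : ∀ j, m j ≤ c j) {t : ℝ}
    (ht : t ∈ Set.Icc (0 : ℝ) 1) (hs : slack N m ≤ surplus m (load P T t)) :
    ∑ j with T j ≤ t, (load P T 1 j - m j) = slack N m := by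
  rw [← le_antisymm (h.surplus_le t ht) hs, ← sum_sub_eq_surplus m _ {j | T j ≤ t}]
  · refine Finset.sum_congr rfl fun j hj => ?_
    rw [load_eq_of_le P (Finset.mem_filter.1 hj).2 (h.le_one j)]
  · intro j hj
    exact le_of_not_open hmc (h.not_open_of_le (Finset.mem_filter.1 hj).2 ht)
  · intro j hj
    simp only [Finset.mem_filter, Finset.mem_univ, true_and, not_le] at hj
    rcases ((h.open_iff t ht j).2 hj).2 with h1 | h1
    · exact absurd hs h1.not_ge
    · exact h1.le

/-- Two schedules coincide as long as all agents eat the same objects in both. -/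
theorem IsSchedule.coincide (h : IsSchedule c m P T) (h' : IsSchedule c m P' T') {τ : ℝ}
    (hτ : τ ≤ 1)
    (heat : ∀ t, 0 ≤ t → t < τ → (∀ k, t < T k ↔ t < T' k) →
      ∀ i j, Eats (P i) T t j ↔ Eats (P' i) T' t j) :
    (∀ t ≤ τ, ∀ k, t < T k ↔ t < T' k) ∧
      ∀ i j, eaten (P i) T τ j = eaten (P' i) T' τ j := by
  classical
  -- Take the disagreement with the earliest time `u`. Before `u` availability agrees, so the loads
  -- at `u` agree, and hence so does openness at `u`, contradicting that just one of the two times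
  -- equals `u`.
  have key : ∀ j, T j ≠ T' j → τ < min (T j) (T' j) := by
    by_contra! hcon
    obtain ⟨j0, hj0, hj0'⟩ := hcon
    obtain ⟨j, hj, hmin⟩ := Finset.exists_min_image
      (Finset.univ.filter fun j => T j ≠ T' j) (fun j => min (T j) (T' j)) ⟨j0, by simpa using hj0⟩
    simp only [Finset.mem_filter, Finset.mem_univ, true_and] at hj hmin
    set u := min (T j) (T' j) with hu
    have huτ : u ≤ τ := (hmin j0 hj0).trans hj0'
    have hu01 : u ∈ Set.Icc (0 : ℝ) 1 :=
      ⟨le_min (h.nonneg j) (h'.nonneg j), huτ.trans hτ⟩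
    have hav : ∀ t < u, ∀ k, t < T k ↔ t < T' k := by
      intro t ht k
      by_cases hk : T k = T' k
      · rw [hk]
      · obtain ⟨h1, h2⟩ := lt_min_iff.1 (ht.trans_le (hmin k hk))
        exact ⟨fun _ => h2, fun _ => h1⟩
    have hload : load P T u = load P' T' u := by
      funext k
      exact Finset.sum_congr rfl fun i _ => eaten_congr fun t h0 h1 =>
        heat t h0 (h1.trans_le huτ) (hav t h1) i k
    have h1 := h.open_iff u hu01 j
    rw [hload, h'.open_iff u hu01 j] at h1
    rcases lt_or_gt_of_ne hj with hlt | hlt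
    · rw [hu, min_eq_left hlt.le] at h1
      exact lt_irrefl _ (h1.1 hlt)
    · rw [hu, min_eq_right hlt.le] at h1
      exact lt_irrefl _ (h1.2 hlt)
  have hav : ∀ t ≤ τ, ∀ k, t < T k ↔ t < T' k := by
    intro t ht k
    by_cases hk : T k = T' k
    · rw [hk]
    · obtain ⟨h1, h2⟩ := lt_min_iff.1 (ht.trans_lt (key k hk))
      exact ⟨fun _ => h2, fun _ => h1⟩
  exact ⟨hav, fun i j => eaten_congr fun t h0 h1 => heat t h0 h1 (hav t h1.le) i j⟩

theorem IsRun.unique [DecidableEq O] {μ ν : ℝ → N → O → ℝ} (hμ : IsRun c m P μ)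
    (hν : IsRun c m P ν) : μ 1 = ν 1 := by
  obtain ⟨T, hT, h1⟩ := hμ.exists_isSchedule
  obtain ⟨T', hT', h2⟩ := hν.exists_isSchedule
  funext i j
  rw [h1 1 (by simp), h2 1 (by simp)]
  exact (hT.coincide hT' le_rfl fun t _ _ h i j => Eats.congr h j).2 i j

end Schedule

/-! ### Existence of a run -/

theorem Ranking.exists_best {O : Type*} [Finite O] (R : Ranking O) {p : O → Prop}
    (h : ∃ j, p j) :
    ∃ k, p k ∧ ∀ j, p j → j ≠ k → R.pref k j := by
  have hwf : WellFounded fun a b => R.pref a b := by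
    have : IsStrictOrder O R.pref := { irrefl := R.irrefl, trans := R.trans }
    exact Finite.wellFounded_of_trans_of_irrefl R.pref
  obtain ⟨k, hk, hmin⟩ := hwf.has_min {j | p j} h
  exact ⟨k, hk, fun j hj hne => (R.total j k hne).resolve_left (hmin j hj)⟩

/-- The path along which each agent `i` eats the object `e i` at unit speed. -/
def linearPath {N O : Type*} [DecidableEq O] (e : N → O) (x : N → O → ℝ) (t₀ t : ℝ) : N → O → ℝ :=
  fun i j => x i j + if j = e i then t - t₀ else 0

section LinearPath

variable {N O : Type*} [DecidableEq O]

theorem continuous_linearPath (e : N → O) (x : N → O → ℝ) (t₀ : ℝ) :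
    Continuous (linearPath e x t₀) := by
  refine continuous_pi fun i => continuous_pi fun j => ?_
  unfold linearPath
  split_ifs <;> fun_prop

theorem linearPath_self (e : N → O) (x : N → O → ℝ) (t₀ : ℝ) : linearPath e x t₀ t₀ = x := by
  funext i j
  simp [linearPath]

theorem linearPath_mono (e : N → O) (x : N → O → ℝ) (t₀ : ℝ) {t u : ℝ} (h : t ≤ u) (i : N)
    (j : O) : linearPath e x t₀ t i j ≤ linearPath e x t₀ u i j := by
  unfold linearPath
  split_ifs <;> linarith

theorem hasDerivWithinAt_linearPath (e : N → O) (x : N → O → ℝ) (t₀ t : ℝ) (i : N) (j : O) :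
    HasDerivWithinAt (fun s => linearPath e x t₀ s i j) (if j = e i then 1 else 0)
      (Set.Ici t) t := by
  unfold linearPath
  split_ifs
  · exact (((hasDerivAt_id t).sub_const _).const_add _).hasDerivWithinAt
  · exact hasDerivWithinAt_const _ _ _

theorem sum_linearPath [Fintype O] (e : N → O) (x : N → O → ℝ) (t₀ t : ℝ) (i : N) :
    ∑ j, linearPath e x t₀ t i j = ∑ j, x i j + (t - t₀) := by
  simp [linearPath, Finset.sum_add_distrib]

end LinearPath

theorem continuous_marginal {N O : Type*} [Fintype N] :
    Continuous (marginal : (N → O → ℝ) → O → ℝ) := by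
  unfold marginal; fun_prop

section Existence

variable {N O : Type*} [Fintype N] [Fintype O] [DecidableEq O] {c m : O → ℕ}

open Classical in
/-- From every feasible state at time `t₀` the eating process can be continued up to time `1`. -/
theorem exists_continuation (hmc : ∀ j, m j ≤ c j) (hcap : Fintype.card N ≤ ∑ j, c j)
    (P : N → Ranking O) (n : ℕ) :
    ∀ (t₀ : ℝ) (x : N → O → ℝ), 0 ≤ t₀ → t₀ ≤ 1 → (∀ i, ∑ j, x i j = t₀) →
      SubAllocation c m x →
      (Finset.univ.filter fun j => Open N c m (marginal x) j).card ≤ n →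
      ∃ μ : ℝ → N → O → ℝ, μ t₀ = x ∧ ContinuousOn μ (Set.Icc t₀ 1) ∧
        (∀ t ∈ Set.Icc t₀ 1, SubAllocation c m (μ t)) ∧
        ∀ t ∈ Set.Ico t₀ 1, ∀ i, ∃ k, IsFavorite c m (P i) (μ t) k ∧
          HasDerivWithinAt (fun s => μ s i k) 1 (Set.Ici t) t ∧
          ∀ j, j ≠ k → HasDerivWithinAt (fun s => μ s i j) 0 (Set.Ici t) t := by
  induction n using Nat.strong_induction_on with
  | _ n ih =>
  intro t₀ x h0 h1 hrow hx hn
  rcases isEmpty_or_nonempty N with hN | hN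
  · exact ⟨fun _ => x, rfl, continuousOn_const, fun _ _ => hx, fun _ _ i => hN.elim i⟩
  rcases h1.eq_or_lt with h1 | h1
  · subst h1
    refine ⟨fun _ => x, rfl, continuousOn_const, fun _ _ => hx, fun t ht => ?_⟩
    simp at ht
  have htot : ∑ j, marginal x j < Fintype.card N := by
    simp only [marginal]
    rw [Finset.sum_comm, Finset.sum_congr rfl fun i _ => hrow i]
    have : (0 : ℝ) < Fintype.card N := by exact_mod_cast Fintype.card_pos
    simpa using mul_lt_of_lt_one_right this h1
  have hfav : ∀ i, ∃ k, Open N c m (marginal x) k ∧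
      ∀ j, Open N c m (marginal x) j → j ≠ k → (P i).pref k j := fun i =>
    (P i).exists_best (exists_open_of_total_lt hmc hcap htot)
  choose e heo hebest using hfav
  set lin := linearPath e x t₀ with hlin
  have hlinmono : ∀ {t u : ℝ}, t ≤ u → ∀ j, marginal (lin t) j ≤ marginal (lin u) j :=
    fun h j => Finset.sum_le_sum fun i _ => linearPath_mono e x t₀ h i j
  have hlin0 : lin t₀ = x := linearPath_self e x t₀
  have hlincont : Continuous lin := continuous_linearPath e x t₀
  have hconst : ∀ t j, ¬ Open N c m (marginal x) j → marginal (lin t) j = marginal x j := by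
    intro t j hj
    refine Finset.sum_congr rfl fun i _ => ?_
    have : j ≠ e i := fun h => hj (h ▸ heo i)
    simp [hlin, linearPath, this]
  -- The infimum of `Z` is the first time an open object closes, or 1. Past it the number of open
  -- objects has dropped, which drives the induction.
  let Z : Set ℝ := {t | t ∈ Set.Icc t₀ 1 ∧
    (t = 1 ∨ ∃ j, Open N c m (marginal x) j ∧ ¬ Open N c m (marginal (lin t)) j)}
  have hZc : IsClosed Z := by
    refine isClosed_Icc.inter ?_
    have h2 : {t : ℝ | t = 1 ∨ ∃ j, Open N c m (marginal x) j ∧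
        ¬ Open N c m (marginal (lin t)) j} =
        {1} ∪ ⋃ j ∈ {j | Open N c m (marginal x) j},
          {t | ¬ Open N c m (marginal (lin t)) j} := by
      ext t; simp
    change IsClosed {t : ℝ | t = 1 ∨ _}
    rw [h2]
    refine isClosed_singleton.union (Set.Finite.isClosed_biUnion (Set.toFinite _) fun j _ => ?_)
    exact (isClosed_not_open c m j).preimage (continuous_marginal.comp hlincont)
  have hZb : BddBelow Z := ⟨t₀, fun t ht => ht.1.1⟩
  have ht1 : sInf Z ∈ Z := hZc.csInf_mem ⟨1, ⟨h1.le, le_rfl⟩, Or.inl rfl⟩ hZb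
  set t₁ := sInf Z with ht₁
  have ht01 : t₀ < t₁ := by
    refine lt_of_le_of_ne ht1.1.1 fun heq => ?_
    rcases ht1.2 with h2 | ⟨j, h2, h3⟩
    · linarith
    · rw [← heq, hlin0] at h3
      exact h3 h2
  have hopen : ∀ t ∈ Set.Ico t₀ t₁, ∀ j,
      Open N c m (marginal (lin t)) j ↔ Open N c m (marginal x) j := by
    intro t ht j
    constructor
    · intro h2
      have := h2.of_le (hlinmono ht.1)
      rwa [hlin0] at this
    · intro h2
      by_contra h3
      exact (csInf_le hZb ⟨⟨ht.1, ht.2.le.trans ht1.1.2⟩, Or.inr ⟨j, h2, h3⟩⟩).not_gt ht.2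
  have hfeas : ∀ t ∈ Set.Icc t₀ t₁, (∀ j, marginal (lin t) j ≤ c j) ∧
      surplus m (marginal (lin t)) ≤ slack N m := by
    have hcl : IsClosed {t | (∀ j, marginal (lin t) j ≤ c j) ∧
        surplus m (marginal (lin t)) ≤ slack N m} := by
      have hc1 : Continuous fun t => marginal (lin t) := continuous_marginal.comp hlincont
      refine IsClosed.inter (s₁ := {t | ∀ j, marginal (lin t) j ≤ c j}) ?_
        (isClosed_le ((continuous_surplus m).comp hc1) continuous_const)
      have h2 : {t | ∀ j, marginal (lin t) j ≤ c j} = ⋂ j, {t | marginal (lin t) j ≤ c j} := by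
        ext t; simp
      rw [h2]
      exact isClosed_iInter fun j => isClosed_le ((continuous_apply j).comp hc1) continuous_const
    rw [← closure_Ico ht01.ne]
    refine hcl.closure_subset_iff.2 fun t ht => ⟨fun j => ?_, ?_⟩
    · by_cases hj : Open N c m (marginal x) j
      · exact ((hopen t ht j).2 hj).1.le
      · rw [hconst t j hj]
        exact hx.cap j
    -- If the slack were exceeded, every open object would be below its minimum and contribute
    -- nothing, while closed objects keep their initial load; so the surplus could not have grown.
    · by_contra! hgt
      refine hgt.not_ge (le_trans (Finset.sum_le_sum fun j _ => ?_) (surplus_le_slack hx))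
      by_cases hj : Open N c m (marginal x) j
      · rcases ((hopen t ht j).2 hj).2 with h2 | h2
        · exact absurd h2 hgt.not_gt
        · rw [max_eq_right (sub_neg.2 h2).le]
          exact le_max_right _ _
      · rw [hconst t j hj]
  have hrow' : ∀ t i, ∑ j, lin t i j = t := by
    intro t i
    rw [hlin, sum_linearPath, hrow]
    ring
  have hsub : ∀ t ∈ Set.Icc t₀ t₁, SubAllocation c m (lin t) := by
    intro t ht
    refine subAllocation_of_surplus_le (fun i j => ?_) (fun i => ?_) (hfeas t ht).1 (hfeas t ht).2
    · have := linearPath_mono e x t₀ ht.1 i j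
      rw [linearPath_self] at this
      exact (hx.nonneg i j).trans this
    · rw [hrow']
      exact ht.2.trans ht1.1.2
  have hlineats : ∀ t ∈ Set.Ico t₀ t₁, ∀ i, IsFavorite c m (P i) (lin t) (e i) := by
    intro t ht i
    have h2 := hsub t (Set.Ico_subset_Icc_self ht)
    simp only [IsFavorite, available_iff_open h2, hopen t ht]
    exact ⟨heo i, hebest i⟩
  obtain ⟨ν, hν0, hνc, hνs, hνe⟩ : ∃ μ : ℝ → N → O → ℝ, μ t₁ = lin t₁ ∧
      ContinuousOn μ (Set.Icc t₁ 1) ∧ (∀ t ∈ Set.Icc t₁ 1, SubAllocation c m (μ t)) ∧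
        ∀ t ∈ Set.Ico t₁ 1, ∀ i, ∃ k, IsFavorite c m (P i) (μ t) k ∧
          HasDerivWithinAt (fun s => μ s i k) 1 (Set.Ici t) t ∧
          ∀ j, j ≠ k → HasDerivWithinAt (fun s => μ s i j) 0 (Set.Ici t) t := by
    have hsub1 := hsub t₁ ⟨ht01.le, le_rfl⟩
    rcases ht1.2 with h2 | ⟨j, h2, h3⟩
    · refine ⟨fun _ => lin t₁, rfl, continuousOn_const, fun _ _ => hsub1, fun t ht => ?_⟩
      rw [h2] at ht
      simp at ht
    · refine ih _ (lt_of_lt_of_le ?_ hn) t₁ (lin t₁) (h0.trans ht01.le) ht1.1.2 (hrow' t₁)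
        hsub1 le_rfl
      refine Finset.card_lt_card ((Finset.ssubset_iff_of_subset fun k hk => ?_).2
        ⟨j, by simpa using h2, by simpa using h3⟩)
      simp only [Finset.mem_filter, Finset.mem_univ, true_and] at hk ⊢
      have := hk.of_le (hlinmono ht01.le)
      rwa [hlin0] at this
  have hgl : ∀ t, t < t₁ → (fun s => if s < t₁ then lin s else ν s) =ᶠ[nhds t] lin := by
    intro t ht
    filter_upwards [Iio_mem_nhds ht] with s hs
    exact if_pos hs
  have hgr : ∀ t, t₁ ≤ t → ∀ s ∈ Set.Ici t, (if s < t₁ then lin s else ν s) = ν s :=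
    fun t ht s hs => if_neg (ht.trans hs).not_gt
  refine ⟨fun s => if s < t₁ then lin s else ν s, ?_, ?_, ?_, ?_⟩
  · simp [ht01, hlin0]
  · rw [← Set.Icc_union_Icc_eq_Icc ht01.le ht1.1.2]
    refine ContinuousOn.union_of_isClosed ?_ ?_ isClosed_Icc isClosed_Icc
    · refine hlincont.continuousOn.congr fun t ht => ?_
      rcases ht.2.eq_or_lt with h2 | h2
      · simp [h2, hν0]
      · simp [h2]
    · exact hνc.congr fun t ht => hgr t₁ le_rfl t ht.1
  · intro t ht
    by_cases h2 : t < t₁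
    · simpa only [h2, if_true] using hsub t ⟨ht.1, h2.le⟩
    · simpa only [h2, if_false] using hνs t ⟨not_lt.1 h2, ht.2⟩
  · intro t ht i
    by_cases h2 : t < t₁
    · simp only [h2, if_true]
      have hd : ∀ j, HasDerivWithinAt (fun s => (if s < t₁ then lin s else ν s) i j)
          (if j = e i then 1 else 0) (Set.Ici t) t := by
        intro j
        refine (hasDerivWithinAt_linearPath e x t₀ t i j).congr_of_eventuallyEq_of_mem ?_
          Set.self_mem_Ici
        exact ((hgl t h2).filter_mono nhdsWithin_le_nhds).mono fun s hs =>
          congrFun (congrFun hs i) j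
      refine ⟨e i, hlineats t ⟨ht.1, h2⟩ i, ?_, fun j hj => ?_⟩
      · simpa using hd (e i)
      · simpa [hj] using hd j
    · have h3 := not_lt.1 h2
      simp only [h2, if_false]
      obtain ⟨k, hk, hk1, hk2⟩ := hνe t ⟨h3, ht.2⟩ i
      refine ⟨k, hk, hk1.congr (fun s hs => ?_) ?_, fun j hj =>
        (hk2 j hj).congr (fun s hs => ?_) ?_⟩
      · rw [hgr t h3 s hs]
      · rw [hgr t h3 t Set.self_mem_Ici]
      · rw [hgr t h3 s hs]
      · rw [hgr t h3 t Set.self_mem_Ici]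

theorem exists_isRun (hmc : ∀ j, m j ≤ c j) (hcap : Fintype.card N ≤ ∑ j, c j)
    (hmin : ∑ j, m j ≤ Fintype.card N) (P : N → Ranking O) : ∃ μ, IsRun c m P μ := by
  classical
  have hs : SubAllocation c m (0 : N → O → ℝ) := by
    have h1 : (∑ j, (m j : ℝ)) ≤ Fintype.card N := by exact_mod_cast hmin
    refine subAllocation_of_surplus_le (by simp) (by simp) (by simp [marginal]) ?_
    simpa [surplus, slack, marginal] using h1
  obtain ⟨μ, h0, hc, hs, he⟩ := exists_continuation hmc hcap P _ 0 0 le_rfl zero_le_one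
    (by simp) hs le_rfl
  exact ⟨μ, h0, hc, hs, he⟩

end Existence

/-! ### The polytope of random allocations and Birkhoff's theorem -/

theorem marginal_combo {N O : Type*} [Fintype N] (μ ν : N → O → ℝ) (a b : ℝ) (j : O) :
    marginal (a • μ + b • ν) j = a * marginal μ j + b * marginal ν j := by
  simp [marginal, Finset.sum_add_distrib, Finset.mul_sum]

theorem sum_ite_eq_sigma_mk {ι : Type*} {α : ι → Type*} [DecidableEq ι] [∀ i, Fintype (α i)]
    [DecidableEq (Sigma α)] (k : Sigma α) (i : ι) :
    ∑ q, (if k = ⟨i, q⟩ then (1 : ℝ) else 0) = if k.1 = i then 1 else 0 := by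
  classical
  obtain ⟨i', q'⟩ := k
  by_cases hi : i' = i
  · subst hi
    simp
  · simp [hi]

section Implementable

variable {N O : Type*} [Fintype N] [Fintype O] {c m : O → ℕ}

/-- The random allocations described by inequalities. -/
def feasible (c m : O → ℕ) : Set (N → O → ℝ) :=
  {ν | (∀ i j, 0 ≤ ν i j) ∧ (∀ i, ∑ j, ν i j = 1) ∧
    (∀ j, marginal ν j ≤ c j) ∧ ∀ j, (m j : ℝ) ≤ marginal ν j}

theorem convex_feasible : Convex ℝ (feasible c m : Set (N → O → ℝ)) := by
  rintro μ ⟨h1, h2, h3, h4⟩ ν ⟨k1, k2, k3, k4⟩ a b ha hb hab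
  refine ⟨fun i j => ?_, fun i => ?_, fun j => ?_, fun j => ?_⟩
  · exact add_nonneg (mul_nonneg ha (h1 i j)) (mul_nonneg hb (k1 i j))
  · simp [Finset.sum_add_distrib, ← Finset.mul_sum, h2, k2, hab]
  · rw [marginal_combo, ← one_mul (c j : ℝ), ← hab, add_mul]
    exact add_le_add (mul_le_mul_of_nonneg_left (h3 j) ha) (mul_le_mul_of_nonneg_left (k3 j) hb)
  · rw [marginal_combo, ← one_mul (m j : ℝ), ← hab, add_mul]
    exact add_le_add (mul_le_mul_of_nonneg_left (h4 j) ha) (mul_le_mul_of_nonneg_left (k4 j) hb)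

theorem implementable_subset_feasible :
    (implementable c m : Set (N → O → ℝ)) ⊆ feasible c m := by
  refine convexHull_min ?_ convex_feasible
  rintro M ⟨h1, h2, h3, h4⟩
  refine ⟨fun i j => ?_, h2, h3, h4⟩
  rcases h1 i j with h | h <;> simp [h]

theorem surplus_le_of_feasible {ν : N → O → ℝ} (h : ν ∈ feasible c m) :
    surplus m (marginal ν) ≤ slack N m := by
  have h1 := sum_sub_eq_surplus m (marginal ν) Finset.univ (fun j _ => h.2.2.2 j)
    (fun j hj => absurd (Finset.mem_univ j) hj)
  have h2 : ∑ j, marginal ν j = Fintype.card N := by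
    simp only [marginal]
    rw [Finset.sum_comm, Finset.sum_congr rfl fun i _ => h.2.1 i]
    simp
  rw [← h1, sum_sub_eq (N := N), h2]
  simp

/-- Every point of the polytope `feasible c m` is a lottery over deterministic allocations. Object
`j` is split into `m j` mandatory and `c j - m j` optional copies, and dummy agents, who may only
use optional copies, are added in order to apply Birkhoff's theorem. -/
theorem feasible_subset_implementable (hmc : ∀ j, m j ≤ c j)
    (hcap : Fintype.card N ≤ ∑ j, c j) :
    (feasible c m : Set (N → O → ℝ)) ⊆ implementable c m := by
  classical
  rintro ν ⟨h1, h2, h3, h4⟩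
  let A := Fin (∑ j, c j - Fintype.card N)
  let K := Σ j, Fin (m j) ⊕ Fin (c j - m j)
  have hcard : Fintype.card (N ⊕ A) = Fintype.card K := by
    simp only [A, K, Fintype.card_sum, Fintype.card_sigma, Fintype.card_fin]
    rw [Finset.sum_congr rfl fun j _ => Nat.add_sub_of_le (hmc j)]
    exact Nat.add_sub_of_le hcap
  let φ : N ⊕ A ≃ K := Fintype.equivOfCardEq hcard
  set x := marginal ν with hx
  have hx0 : ∀ j, 0 ≤ x j := fun j => Finset.sum_nonneg fun i _ => h1 i j
  have hxz : ∀ i j, x j = 0 → ν i j = 0 := fun i j h =>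
    (Finset.sum_eq_zero_iff_of_nonneg fun i _ => h1 i j).1 h i (Finset.mem_univ i)
  have hxtot : ∑ j, x j = Fintype.card N := by
    simp only [hx, marginal]
    rw [Finset.sum_comm, Finset.sum_congr rfl fun i _ => h2 i]
    simp
  -- The share of each optional copy of `j` used by real agents. Mandatory copies are used fully,
  -- and dummies split the remainder equally.
  let β : O → ℝ := fun j => (x j - m j) / (c j - m j)
  have hβ0 : ∀ j, 0 ≤ β j := fun j =>
    div_nonneg (sub_nonneg.2 (h4 j)) (sub_nonneg.2 (Nat.cast_le.2 (hmc j)))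
  have hβ1 : ∀ j, β j ≤ 1 := fun j =>
    div_le_one_of_le₀ (sub_le_sub_right (h3 j) _) (sub_nonneg.2 (Nat.cast_le.2 (hmc j)))
  have hβm : ∀ j, ((c j - m j : ℕ) : ℝ) * β j = x j - m j := by
    intro j
    rw [Nat.cast_sub (hmc j)]
    by_cases h : (c j : ℝ) - m j = 0
    · have e1 := h3 j
      have e2 := h4 j
      rw [h, zero_mul]
      linarith
    · exact mul_div_cancel₀ _ h
  let M : N ⊕ A → K → ℝ := fun a k => match a, k with
    | Sum.inl i, ⟨j, Sum.inl _⟩ => ν i j / x j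
    | Sum.inl i, ⟨j, Sum.inr _⟩ => β j * (ν i j / x j)
    | Sum.inr _, ⟨_, Sum.inl _⟩ => 0
    | Sum.inr _, ⟨j, Sum.inr _⟩ => (1 - β j) / Fintype.card A
  have hM0 : ∀ a k, 0 ≤ M a k := by
    rintro (i | d) ⟨j, q | q⟩
    · exact div_nonneg (h1 i j) (hx0 j)
    · exact mul_nonneg (hβ0 j) (div_nonneg (h1 i j) (hx0 j))
    · exact le_rfl
    · exact div_nonneg (sub_nonneg.2 (hβ1 j)) (Nat.cast_nonneg _)
  have hrep : ∀ i j, ∑ q, M (Sum.inl i) ⟨j, q⟩ = ν i j := by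
    intro i j
    simp only [Fintype.sum_sum_type, M, Finset.sum_const, Finset.card_univ, Fintype.card_fin,
      nsmul_eq_mul]
    rw [← mul_assoc, hβm, ← add_mul]
    by_cases h : x j = 0
    · simp [h, hxz i j h]
    · field_simp
      ring
  have hcardA : (Fintype.card A : ℝ) = ∑ j, (c j : ℝ) - Fintype.card N := by
    simp only [A, Fintype.card_fin]
    rw [Nat.cast_sub hcap]
    push_cast
    rfl
  have hsumβ : ∑ j, ((c j - m j : ℕ) : ℝ) * (1 - β j) = Fintype.card A := by
    have : ∀ j, ((c j - m j : ℕ) : ℝ) * (1 - β j) = c j - x j := by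
      intro j
      rw [mul_sub, hβm, Nat.cast_sub (hmc j)]
      ring
    rw [Finset.sum_congr rfl fun j _ => this j, Finset.sum_sub_distrib, hxtot, hcardA]
  have hMrow : ∀ a, ∑ k, M a k = 1 := by
    rintro (i | d)
    · rw [Fintype.sum_sigma, Finset.sum_congr rfl fun j _ => hrep i j, h2]
    · have hA : (Fintype.card A : ℝ) ≠ 0 := by
        have : 0 < Fintype.card A := Fintype.card_pos_iff.2 ⟨d⟩
        exact_mod_cast this.ne'
      rw [Fintype.sum_sigma]
      simp only [Fintype.sum_sum_type, M, Finset.sum_const, Finset.card_univ, Fintype.card_fin,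
        nsmul_eq_mul, mul_zero, zero_add]
      simp only [← mul_div_assoc]
      rw [← Finset.sum_div, hsumβ]
      exact div_self hA
  have hMcol : ∀ k, ∑ a, M a k = 1 := by
    rintro ⟨j, q | q⟩
    · have hpos : x j ≠ 0 := by
        have h5 : 0 < m j := q.pos
        have h6 : (0 : ℝ) < m j := by exact_mod_cast h5
        exact (h6.trans_le (h4 j)).ne'
      simp only [Fintype.sum_sum_type, M, Finset.sum_const_zero, add_zero]
      rw [← Finset.sum_div]
      exact div_self hpos
    · have e1 : ∑ i, β j * (ν i j / x j) = β j := by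
        rw [← Finset.mul_sum, ← Finset.sum_div]
        change β j * (x j / x j) = β j
        by_cases h : x j = 0
        · have e2 := h4 j
          rw [h] at e2
          have e3 : (m j : ℝ) = 0 := le_antisymm e2 (Nat.cast_nonneg _)
          simp [β, h, e3]
        · rw [div_self h, mul_one]
      have e2 : (Fintype.card A : ℝ) * ((1 - β j) / Fintype.card A) = 1 - β j := by
        by_cases h : (Fintype.card A : ℝ) = 0
        · have e3 := (Finset.sum_eq_zero_iff_of_nonneg fun j _ =>
            mul_nonneg (Nat.cast_nonneg _) (sub_nonneg.2 (hβ1 j))).1 (hsumβ.trans h) j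
            (Finset.mem_univ j)
          have e4 : ((c j - m j : ℕ) : ℝ) ≠ 0 := by exact_mod_cast q.pos.ne'
          rw [(mul_eq_zero.1 e3).resolve_left e4]
          simp
        · exact mul_div_cancel₀ _ h
      simp only [Fintype.sum_sum_type, M, Finset.sum_const, Finset.card_univ, nsmul_eq_mul]
      rw [e1, e2]
      ring
  have hB : (Matrix.of fun a b => M a (φ b)) ∈ doublyStochastic ℝ (N ⊕ A) := by
    refine mem_doublyStochastic_iff_sum.2 ⟨fun a b => hM0 a _, fun a => ?_, fun b => hMcol _⟩
    simp only [Matrix.of_apply]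
    rw [φ.sum_comp (M a), hMrow]
  obtain ⟨w, hw0, hw1, hwM⟩ := exists_eq_sum_perm_of_mem_doublyStochastic hB
  have hentry : ∀ a k, M a k = ∑ σ, w σ * if φ (σ a) = k then 1 else 0 := by
    intro a k
    have e1 := congrFun (congrFun hwM a) (φ.symm k)
    simp only [Matrix.sum_apply, Matrix.smul_apply, smul_eq_mul, Matrix.of_apply,
      Equiv.apply_symm_apply] at e1
    rw [← e1]
    refine Finset.sum_congr rfl fun σ _ => ?_
    simp [Equiv.Perm.permMatrix, PEquiv.toMatrix_apply, Equiv.eq_symm_apply]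
  let D : Equiv.Perm (N ⊕ A) → N → O → ℝ := fun σ i j =>
    if (φ (σ (Sum.inl i))).1 = j then 1 else 0
  have hνD : ν = ∑ σ, w σ • D σ := by
    funext i j
    rw [← hrep i j]
    simp only [Finset.sum_apply, Pi.smul_apply, smul_eq_mul, hentry]
    rw [Finset.sum_comm]
    refine Finset.sum_congr rfl fun σ _ => ?_
    rw [← Finset.mul_sum]
    congr 1
    exact sum_ite_eq_sigma_mk (α := fun j => Fin (m j) ⊕ Fin (c j - m j)) _ _
  have hD : ∀ σ, w σ ≠ 0 → D σ ∈ allowable c m := by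
    intro σ hσ
    let ψ : N ⊕ A ≃ K := (Equiv.trans σ φ : N ⊕ A ≃ K)
    -- A permutation of positive weight avoids the zero entries of `M`. Hence mandatory copies go to
    -- real agents, which gives the minimums.
    have hdummy : ∀ d j q, ψ (Sum.inr d) ≠ ⟨j, Sum.inl q⟩ := by
      intro d j q hd
      have e1 := hentry (Sum.inr d) ⟨j, Sum.inl q⟩
      have e2 : M (Sum.inr d) ⟨j, Sum.inl q⟩ = 0 := rfl
      rw [e2] at e1
      have e3 := (Finset.sum_eq_zero_iff_of_nonneg fun σ _ =>
        mul_nonneg (hw0 σ) (by split_ifs <;> simp)).1 e1.symm σ (Finset.mem_univ σ)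
      have e4 : φ (σ (Sum.inr d)) = ⟨j, Sum.inl q⟩ := hd
      simp [e4, hσ] at e3
    refine ⟨fun i j => ?_, fun i => ?_, fun j => ?_, fun j => ?_⟩
    · simp only [D]
      split_ifs <;> simp
    · simp [D]
    · let g : K → ℝ := fun k => if k.1 = j then 1 else 0
      have e1 : ∑ k, g k = c j := by
        rw [Fintype.sum_sigma, Fintype.sum_eq_single j fun j' hj' => by simp [g, hj']]
        simp only [g, if_true, Finset.sum_const, Finset.card_univ, Fintype.card_sum,
          Fintype.card_fin, Nat.add_sub_of_le (hmc _), nsmul_eq_mul, mul_one]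
      rw [← e1, ← ψ.sum_comp g, Fintype.sum_sum_type]
      refine le_add_of_nonneg_right (Finset.sum_nonneg fun d _ => ?_)
      simp only [g]
      split_ifs <;> simp
    · let g : K → ℝ := fun k => if k.1 = j ∧ k.2.isLeft then 1 else 0
      have e1 : ∑ k, g k = m j := by
        rw [Fintype.sum_sigma]
        simp only [g, Fintype.sum_sum_type]
        simp
      rw [← e1, ← ψ.sum_comp g, Fintype.sum_sum_type]
      have e2 : ∑ d, g (ψ (Sum.inr d)) = 0 := by
        refine Finset.sum_eq_zero fun d _ => ?_
        have hd := hdummy d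
        generalize ψ (Sum.inr d) = k at hd
        obtain ⟨j', q | q⟩ := k
        · exact absurd rfl (hd j' q)
        · simp [g]
      rw [e2, add_zero]
      refine Finset.sum_le_sum fun i _ => ?_
      change (if _ ∧ _ then (1 : ℝ) else 0) ≤ if (ψ (Sum.inl i)).1 = j then 1 else 0
      by_cases hj : (ψ (Sum.inl i)).1 = j
      · rw [if_pos hj]
        split_ifs <;> simp
      · simp [hj]
  rw [hνD, ← Finset.sum_filter_of_ne (p := fun σ => w σ ≠ 0)]
  · refine (convex_convexHull ℝ _).sum_mem (fun σ _ => hw0 σ) ?_ fun σ hσ =>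
      subset_convexHull ℝ _ (hD σ (Finset.mem_filter.1 hσ).2)
    rw [Finset.sum_filter_ne_zero, hw1]
  · intro σ _ hσ hw
    exact hσ (by simp [hw])

end Implementable

/-! ### Efficiency, feasibility, anonymity and envy-freeness -/

theorem FOSD.le_of_eq_above {O : Type*} [Fintype O] {R : Ranking O} {x y : O → ℝ}
    (h : FOSD R x y) {j : O} (hj : ∀ k, R.pref k j → x k = y k) : y j ≤ x j := by
  classical
  have hset : (Finset.univ.filter fun k => k = j ∨ R.pref k j) =
      insert j (Finset.univ.filter fun k => R.pref k j) := by
    ext k; simp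
  have h1 := h j
  have hsum : ∀ z : O → ℝ, (∑ k with (k = j ∨ R.pref k j), z k) =
      z j + ∑ k with R.pref k j, z k := by
    intro z
    rw [hset, Finset.sum_insert (by simpa using R.irrefl j)]
  have h2 : ∑ k with R.pref k j, x k = ∑ k with R.pref k j, y k :=
    Finset.sum_congr rfl fun k hk => hj k (Finset.mem_filter.1 hk).2
  have h3 : y j + ∑ k with R.pref k j, y k ≤ x j + ∑ k with R.pref k j, x k := by
    rw [← hsum, ← hsum]
    convert h1
  linarith

section Properties

variable {N O : Type*} [Fintype N] [Fintype O] {c m : O → ℕ} {P : N → Ranking O}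

theorem IsSchedule.eq_of_FOSD {T : O → ℝ} (h : IsSchedule c m P T) (hmc : ∀ j, m j ≤ c j)
    {ν : N → O → ℝ} (hν : ν ∈ feasible c m)
    (hdom : ∀ i, FOSD (P i) (ν i) (eaten (P i) T 1)) (i : N) (j : O) :
    ν i j = eaten (P i) T 1 j := by
  classical
  by_contra hne
  obtain ⟨a, ha, hmin⟩ := Finset.exists_min_image
    (Finset.univ.filter fun j => ∃ i, ν i j ≠ eaten (P i) T 1 j) T
    ⟨j, by simpa using ⟨i, hne⟩⟩
  simp only [Finset.mem_filter, Finset.mem_univ, true_and, forall_exists_index] at ha hmin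
  have hlt : ∀ k, T k < T a → ∀ i, ν i k = eaten (P i) T 1 k := by
    intro k hk i
    by_contra hcon
    exact (hmin k i hcon).not_gt hk
  have hle : ∀ k, T k ≤ T a → ∀ i, eaten (P i) T 1 k ≤ ν i k := by
    intro k hk i
    rcases hk.lt_or_eq with hk | hk
    · exact (hlt k hk i).ge
    rcases (eaten_nonneg (R := P i) (T := T) (t := 1) (j := k)).eq_or_lt with h0 | h0
    · rw [← h0]
      exact hν.1 i k
    -- An agent who eats some `k` has seen everything he prefers exhausted strictly before `T k`,
    -- where both allocations agree by minimality of `T a`.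
    refine (hdom i).le_of_eq_above fun l hl => hlt l ?_ i
    rw [← hk]
    exact ((start_le_iff.1 le_rfl).2 l hl).trans_lt (eaten_pos_iff.1 h0).1
  have hsum : ∀ k, T k ≤ T a → load P T 1 k ≤ marginal ν k := fun k hk =>
    Finset.sum_le_sum fun i _ => hle k hk i
  have hstrict : load P T 1 a < marginal ν a := by
    obtain ⟨i, hi⟩ := ha
    exact Finset.sum_lt_sum (fun i _ => hle a le_rfl i)
      ⟨i, Finset.mem_univ i, lt_of_le_of_ne (hle a le_rfl i) (Ne.symm hi)⟩
  rcases le_or_of_not_open (h.not_open a) with h1 | ⟨h1, -⟩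
  · rw [load_eq_of_le P le_rfl (h.le_one a)] at h1
    exact (h1.trans_lt hstrict).not_ge (hν.2.2.1 a)
  · have h2 := h.sum_sub_eq_slack hmc ⟨h.nonneg a, h.le_one a⟩ h1
    have h3 : ∑ k with T k ≤ T a, (load P T 1 k - m k) <
        ∑ k with T k ≤ T a, (marginal ν k - m k) :=
      Finset.sum_lt_sum (fun k hk => sub_le_sub_right (hsum k (Finset.mem_filter.1 hk).2) _)
        ⟨a, by simp, sub_lt_sub_right hstrict _⟩
    have h4 := sum_sub_le_surplus m (marginal ν) (Finset.univ.filter fun k => T k ≤ T a)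
    have h5 := surplus_le_of_feasible hν
    linarith

variable [DecidableEq O] {μ : ℝ → N → O → ℝ}

theorem IsRun.mem_feasible (h : IsRun c m P μ) : μ 1 ∈ feasible c m := by
  have h1 : (1 : ℝ) ∈ Set.Icc (0 : ℝ) 1 := by simp
  have hs := h.sub 1 h1
  exact ⟨hs.nonneg, fun i => h.sum_eq i 1 h1, hs.cap,
    min_le_of_total (by simpa using h.total_eq h1) (surplus_le_slack hs)⟩

theorem IsRun.comp_perm (h : IsRun c m P μ) (π : Equiv.Perm N) :
    IsRun c m (fun i => P (π i)) (fun t i => μ t (π i)) := by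
  have hm : ∀ t, marginal (fun i => μ t (π i)) = marginal (μ t) := fun t => by
    funext j
    exact Equiv.sum_comp π fun i => μ t i j
  refine ⟨?_, ?_, fun t ht => ?_, fun t ht i => ?_⟩
  · funext i j
    simp [h.init]
  · exact continuousOn_pi.2 fun i => continuousOn_pi.1 h.cont (π i)
  · have hs := h.sub t ht
    refine ⟨fun i => hs.nonneg (π i), fun i => hs.demand (π i), ?_, ?_⟩
    · rw [hm]; exact hs.cap
    · rw [hm]; exact hs.min
  · obtain ⟨k, hk, hd⟩ := h.eats t ht (π i)
    refine ⟨k, ?_, hd⟩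
    unfold IsFavorite Available at hk ⊢
    rw [hm]
    exact hk

/-- All agents choose from the same available set, so whenever `i'` eats from an upper set of `i`'s
ranking, `i` does too. Compare the derivatives. -/
theorem IsRun.fosd (h : IsRun c m P μ) (i i' : N) : FOSD (P i) (μ 1 i) (μ 1 i') := by
  classical
  intro k
  let U : Finset O := Finset.univ.filter fun j => j = k ∨ (P i).pref j k
  have hfav : ∀ i, ∀ t ∈ Set.Ico (0 : ℝ) 1, ∃ l, IsFavorite c m (P i) (μ t) l ∧
      HasDerivWithinAt (fun s => ∑ j ∈ U, μ s i j) (if l ∈ U then 1 else 0) (Set.Ici t) t := by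
    intro i t ht
    obtain ⟨l, hl, h1, h2⟩ := h.eats t ht i
    refine ⟨l, hl, ?_⟩
    have h3 : ∀ j ∈ U, HasDerivWithinAt (fun s => μ s i j) (if l = j then 1 else 0)
        (Set.Ici t) t := by
      intro j _
      split_ifs with hj
      · exact hj ▸ h1
      · exact h2 j (Ne.symm hj)
    simpa using HasDerivWithinAt.fun_sum h3
  have : Nonempty O := ⟨k⟩
  choose! e he hd using hfav
  have hcont : ∀ i, ContinuousOn (fun s => ∑ j ∈ U, μ s i j) (Set.Icc 0 1) := fun i =>
    continuousOn_finsetSum _ fun j _ => h.continuousOn_apply i j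
  have key : ∑ j ∈ U, μ 1 i' j ≤ ∑ j ∈ U, μ 1 i j := by
    refine image_le_of_deriv_right_le_deriv_boundary (hcont i') (hd i') ?_ (hcont i) (hd i)
      (fun t ht => ?_) (Set.right_mem_Icc.2 zero_le_one)
    · simp [h.init]
    · by_cases h1 : e i' t ∈ U
      · have h2 : e i t ∈ U := by
          by_cases heq : e i' t = e i t
          · exact heq ▸ h1
          have h3 := (he i t ht).2 _ (he i' t ht).1 heq
          simp only [U, Finset.mem_filter, Finset.mem_univ, true_and] at h1 ⊢
          rcases h1 with h1 | h1
          · exact Or.inr (h1 ▸ h3)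
          · exact Or.inr ((P i).trans _ _ _ h3 h1)
        simp [h1, h2]
      · rw [if_neg h1]
        split_ifs <;> simp
  convert key

end Properties

/-! ### Weak strategyproofness -/

section Manipulation

variable {N O : Type*} [Fintype N] [Fintype O] {c m : O → ℕ} {P P' : N → Ranking O}
  {T T' : O → ℝ} {a : O} {i₀ : N} {τ : ℝ}

/-- The situation after a misreport of agent `i₀`: the schedules `T` (truth) and `T'` (misreport)
let the agent eat the same objects up to time `τ`, when he starts to eat `a` under truth-telling but not under the
misreport, and `a` is available for longer under the misreport. -/
structure Deviation (c m : O → ℕ) (P P' : N → Ranking O) (T T' : O → ℝ) (i₀ : N) (a : O)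
    (τ : ℝ) : Prop where
  truth : IsSchedule c m P T
  lie : IsSchedule c m P' T'
  others : ∀ i ≠ i₀, P' i = P i
  nonneg : 0 ≤ τ
  before : ∀ t, 0 ≤ t → t < τ → ∀ j, Eats (P i₀) T t j → Eats (P' i₀) T' t j
  eats : Eats (P i₀) T τ a
  longer : T a < T' a

namespace Deviation

theorem eats_of_le (d : Deviation c m P P' T T' i₀ a τ) {t : ℝ} (h : τ ≤ t) (h' : t < T a) :
    Eats (P i₀) T t a :=
  ⟨h', fun k hk => (d.eats.2 k hk).trans h⟩

theorem eaten_le_of_others (d : Deviation c m P P' T T' i₀ a τ) {u : ℝ}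
    (hu : ∀ k, T k < u → T' k ≤ T k) {j : O} (hj : u ≤ T' j) {i : N} (hi : i ≠ i₀) :
    eaten (P i) T u j ≤ eaten (P' i) T' u j := by
  rw [d.others i hi]
  refine eaten_le_eaten fun t _ ht he => ⟨ht.trans_le hj, fun k hk => ?_⟩
  exact (hu k ((he.2 k hk).trans_lt ht)).trans (he.2 k hk)

/-- From `τ` until `T a` the manipulator truthfully eats only `a`, so for `j ≠ a` only times before
`τ` matter, where his meals agree. Other agents turn to `j` no later under the lie, since what they
prefer is exhausted no later. -/
theorem eaten_le (d : Deviation c m P P' T T' i₀ a τ) {u : ℝ} (hua : u ≤ T a)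
    (hu : ∀ k, T k < u → T' k ≤ T k) {j : O} (hja : j ≠ a) (hj : u ≤ T' j) (i : N) :
    eaten (P i) T u j ≤ eaten (P' i) T' u j := by
  by_cases hi : i = i₀
  · subst hi
    refine eaten_le_eaten fun t h0 ht he => d.before t h0 ?_ j he
    by_contra! hτ
    exact hja (he.unique (d.eats_of_le hτ (ht.trans_le hua)))
  · exact d.eaten_le_of_others hu hj hi

/-- Until `a` is exhausted under truth-telling, the misreport only exhausts objects earlier. -/
theorem exhausted_earlier (d : Deviation c m P P' T T' i₀ a τ) {b : O} (hb : T b < T a) :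
    T' b ≤ T b := by
  classical
  by_contra! hcon
  obtain ⟨b, hb, hmin⟩ := Finset.exists_min_image
    (Finset.univ.filter fun b => T b < T a ∧ T b < T' b) T ⟨b, by simpa using ⟨hb, hcon⟩⟩
  simp only [Finset.mem_filter, Finset.mem_univ, true_and, and_imp] at hb hmin
  have hu : ∀ k, T k < T b → T' k ≤ T k := by
    intro k hk
    by_contra! hk'
    exact (hmin k (hk.trans hb.1) hk').not_gt hk
  have hb01 : T b ∈ Set.Icc (0 : ℝ) 1 := ⟨d.truth.nonneg b, d.truth.le_one b⟩
  have hload : ∀ j, j ≠ a → T b ≤ T' j → load P T (T b) j ≤ load P' T' (T b) j :=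
    fun j hja hj => Finset.sum_le_sum fun i _ => d.eaten_le hb.1.le hu hja hj i
  have hba : b ≠ a := fun h => lt_irrefl _ (h ▸ hb.1)
  have hopen := (d.lie.open_iff _ hb01 b).2 hb.2
  have h1 := hload b hba hb.2.le
  rcases le_or_of_not_open (d.truth.not_open b) with h2 | ⟨h2, h3⟩
  · exact hopen.1.not_ge (h2.trans h1)
  have hlt : surplus m (load P' T' (T b)) < slack N m :=
    hopen.2.resolve_right (h3.trans h1).not_gt
  -- The one object for which loads were not compared is harmless: `a` is open although the surplus
  -- is used up, so it is below its minimum and contributes zero.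
  have ha := ((d.truth.open_iff _ hb01 a).2 hb.1).2.resolve_left h2.not_gt
  refine hlt.not_ge (h2.trans (Finset.sum_le_sum fun j _ => ?_))
  by_cases hja : j = a
  · rw [hja, max_eq_right (sub_neg.2 ha).le]
    exact le_max_right _ _
  refine max_le_max (sub_le_sub_right ?_ _) le_rfl
  rcases le_or_gt (T b) (T' j) with hj | hj
  · exact hload j hja hj
  -- An object already closed under the lie while surplus remains must be at capacity, so its load
  -- is maximal.
  rcases le_or_of_not_open (d.lie.not_open_of_le hj.le hb01) with h4 | ⟨h4, -⟩
  · exact (d.truth.load_le _ hb01 j).trans h4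
  · exact absurd hlt h4.not_gt

theorem eaten_final_le (d : Deviation c m P P' T T' i₀ a τ) {j : O} (hj : T j ≤ T a)
    (hj' : T j < T' j) (hja : j ≠ a) (i : N) : eaten (P i) T 1 j ≤ eaten (P' i) T' 1 j := by
  have h1 : T j = T a := by
    by_contra hne
    exact (d.exhausted_earlier (lt_of_le_of_ne hj hne)).not_gt hj'
  rw [eaten_eq_of_le (d.truth.le_one j) hj]
  refine (d.eaten_le le_rfl (fun k => d.exhausted_earlier) hja ?_ i).trans
    (eaten_mono (d.truth.le_one a))
  exact h1 ▸ hj'.le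

/-- Objects which last longer under the misreport give strictly more to the other agents who
consume them. -/
theorem eaten_lt_of_others (d : Deviation c m P P' T T' i₀ a τ) {j : O} (hj : T j ≤ T a)
    (hj' : T j < T' j) {i : N} (hi : i ≠ i₀) (hpos : 0 < eaten (P i) T 1 j) :
    eaten (P i) T 1 j < eaten (P' i) T' 1 j := by
  rw [d.others i hi]
  have h1 := (eaten_pos_iff.1 hpos).1
  have h2 : start (P i) T' j ≤ start (P i) T j := by
    refine start_le_iff.2 ⟨start_nonneg, fun k hk => ?_⟩
    have h3 : T k ≤ start (P i) T j := (start_le_iff.1 le_rfl).2 k hk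
    exact (d.exhausted_earlier ((h3.trans_lt h1).trans_le hj)).trans h3
  simp only [eaten, min_eq_left (d.truth.le_one j), min_eq_left (d.lie.le_one j)]
  rw [max_eq_right (sub_nonneg.2 h1.le)]
  exact lt_max_of_lt_right (by linarith)

theorem eaten_final_le' (d : Deviation c m P P' T T' i₀ a τ)
    (ha : eaten (P i₀) T 1 a ≤ eaten (P' i₀) T' 1 a) {j : O} (hj : T j ≤ T a)
    (hj' : T j < T' j) (i : N) : eaten (P i) T 1 j ≤ eaten (P' i) T' 1 j := by
  by_cases hja : j = a
  · by_cases hi : i = i₀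
    · rw [hi, hja]
      exact ha
    · rcases (eaten_nonneg (R := P i) (T := T) (t := 1) (j := j)).eq_or_lt with h0 | h0
      · rw [← h0]
        exact eaten_nonneg
      · exact (d.eaten_lt_of_others hj hj' hi h0).le
  · exact d.eaten_final_le hj hj' hja i

theorem load_final_le (d : Deviation c m P P' T T' i₀ a τ)
    (ha : eaten (P i₀) T 1 a ≤ eaten (P' i₀) T' 1 a) {j : O} (hj : T j ≤ T a)
    (hj' : T j < T' j) : load P T 1 j ≤ load P' T' 1 j :=
  Finset.sum_le_sum fun i _ => d.eaten_final_le' ha hj hj' i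

/-- Any other consumer of `j` would gain strictly under the lie while nobody loses, which is
incompatible with a load that does not increase. -/
theorem load_eq_eaten (d : Deviation c m P P' T T' i₀ a τ)
    (ha : eaten (P i₀) T 1 a ≤ eaten (P' i₀) T' 1 a) {j : O} (hj : T j ≤ T a)
    (hj' : T j < T' j) (heq : load P' T' 1 j ≤ load P T 1 j) :
    load P T 1 j = eaten (P i₀) T 1 j := by
  classical
  refine Finset.sum_eq_single_of_mem i₀ (Finset.mem_univ _) fun i _ hi => ?_
  by_contra hne
  have h0 := lt_of_le_of_ne eaten_nonneg (Ne.symm hne)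
  exact heq.not_gt (Finset.sum_lt_sum (fun i _ => d.eaten_final_le' ha hj hj' i)
    ⟨i, Finset.mem_univ i, d.eaten_lt_of_others hj hj' hi h0⟩)

theorem eaten_pos (d : Deviation c m P P' T T' i₀ a τ) : 0 < eaten (P i₀) T 1 a := by
  have h1 := (eats_iff d.nonneg).1 d.eats
  exact eaten_pos_iff.2 ⟨h1.1.trans_lt h1.2, (h1.1.trans_lt h1.2).trans_le (d.truth.le_one a)⟩

theorem sum_eaten_lt_one (d : Deviation c m P P' T T' i₀ a τ) (H : Finset O)
    (hH : ∀ j ∈ H, T j ≤ T a) : ∑ j ∈ H, eaten (P i₀) T 1 j < 1 := by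
  have h1 : ∑ j ∈ H, eaten (P i₀) T 1 j = ∑ j ∈ H, eaten (P i₀) T (T a) j :=
    Finset.sum_congr rfl fun j hj => eaten_eq_of_le (d.truth.le_one j) (hH j hj)
  have h2 : ∑ j ∈ H, eaten (P i₀) T (T a) j ≤ ∑ j, eaten (P i₀) T (T a) j :=
    Finset.sum_le_sum_of_subset_of_nonneg (Finset.subset_univ H) fun _ _ _ => eaten_nonneg
  rw [d.truth.sum_eaten _ ⟨d.truth.nonneg a, d.truth.le_one a⟩] at h2
  rw [h1]
  exact h2.trans_lt (d.longer.trans_le (d.lie.le_one a))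

/-- The sum is positive because the manipulator eats some `a`, and below 1 because all of it is
eaten by time `T a < T' a ≤ 1`. -/
theorem not_integer (d : Deviation c m P P' T T' i₀ a τ) {H : Finset O}
    (hH : ∀ j ∈ H, T j ≤ T a) (haH : a ∈ H) (z : ℤ) : ∑ j ∈ H, eaten (P i₀) T 1 j ≠ z := by
  intro hz
  have h1 := d.sum_eaten_lt_one H hH
  have h2 : 0 < ∑ j ∈ H, eaten (P i₀) T 1 j :=
    d.eaten_pos.trans_le (Finset.single_le_sum (f := fun j => eaten (P i₀) T 1 j)
      (fun _ _ => eaten_nonneg) haH)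
  rw [hz] at h1 h2
  have h3 : z < 1 := by exact_mod_cast h1
  have h4 : 0 < z := by exact_mod_cast h2
  omega

theorem load_ne_natCast (d : Deviation c m P P' T T' i₀ a τ)
    (ha : eaten (P i₀) T 1 a ≤ eaten (P' i₀) T' 1 a)
    (heq : load P' T' 1 a ≤ load P T 1 a) (n : ℕ) : load P T 1 a ≠ n := by
  intro hn
  refine d.not_integer (H := {a}) (by simp) (by simp) n ?_
  rw [Finset.sum_singleton, ← d.load_eq_eaten ha le_rfl d.longer heq, hn]
  simp

/-- A deviation leaves the agent with strictly less of the object `a`. -/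
theorem eaten_lt (d : Deviation c m P P' T T' i₀ a τ) (hmc : ∀ j, m j ≤ c j) :
    eaten (P' i₀) T' 1 a < eaten (P i₀) T 1 a := by
  classical
  by_contra! ha
  have h1mem : (1 : ℝ) ∈ Set.Icc (0 : ℝ) 1 := by simp
  have hle := d.load_final_le ha le_rfl d.longer
  have hTa : T a ∈ Set.Icc (0 : ℝ) 1 := ⟨d.truth.nonneg a, d.truth.le_one a⟩
  have hfin : load P T (T a) a = load P T 1 a := load_eq_of_le P le_rfl (d.truth.le_one a)
  rcases le_or_of_not_open (d.truth.not_open a) with hc | ⟨hs, hm⟩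
  · rw [hfin] at hc
    have h1 := d.lie.load_le 1 h1mem a
    exact d.load_ne_natCast ha (h1.trans hc) (c a) (le_antisymm (hle.trans h1) hc)
  rw [hfin] at hm
  -- If the lie uses up the surplus while `a` is still open, `a` can only be filled up to `m a`,
  -- which pins its load to an integer. Otherwise every object exhausted before `T' a` under the lie
  -- is at capacity.
  by_cases hA : ∃ t ∈ Set.Ico 0 (T' a), slack N m ≤ surplus m (load P' T' t)
  · obtain ⟨t, ht, hst⟩ := hA
    have h1 : ∀ u ∈ Set.Ico t (T' a), load P' T' u a ≤ m a := by
      intro u hu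
      have hu01 : u ∈ Set.Icc (0 : ℝ) 1 := ⟨ht.1.trans hu.1, hu.2.le.trans (d.lie.le_one a)⟩
      refine (((d.lie.open_iff u hu01 a).2 hu.2).2.resolve_left ?_).le
      exact (hst.trans (surplus_mono m fun j => load_mono P' T' hu.1 j)).not_gt
    have hcl : IsClosed {u | load P' T' u a ≤ m a} :=
      isClosed_le (continuous_finsetSum _ fun i _ => continuous_eaten _ _ _) continuous_const
    have h2 : T' a ∈ closure (Set.Ico t (T' a)) := by
      rw [closure_Ico ht.2.ne]
      exact Set.right_mem_Icc.2 ht.2.le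
    have h3 : load P' T' (T' a) a ≤ m a := hcl.closure_subset_iff.2 h1 h2
    rw [load_eq_of_le P' le_rfl (d.lie.le_one a)] at h3
    exact d.load_ne_natCast ha (h3.trans hm) (m a) (le_antisymm (hle.trans h3) hm)
  · push Not at hA
    set G : Finset O := Finset.univ.filter fun j => T j ≤ T a with hG
    have hGmem : ∀ j, j ∈ G ↔ T j ≤ T a := fun j => by simp [hG]
    have hcapped : ∀ j ∈ G, ¬ T j < T' j → load P' T' 1 j = c j := by
      intro j hj hj'
      have h2 : T' j < T' a := (not_lt.1 hj').trans_lt (((hGmem j).1 hj).trans_lt d.longer)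
      have h3 := hA (T' j) ⟨d.lie.nonneg j, h2⟩
      have h4 := (le_or_of_not_open (d.lie.not_open j)).resolve_right fun h => h3.not_ge h.1
      rw [load_eq_of_le P' le_rfl (d.lie.le_one j)] at h4
      exact le_antisymm (d.lie.load_le 1 h1mem j) h4
    have hmono : ∀ j ∈ G, load P T 1 j ≤ load P' T' 1 j := by
      intro j hj
      by_cases hj' : T j < T' j
      · exact d.load_final_le ha ((hGmem j).1 hj) hj'
      · rw [hcapped j hj hj']
        exact d.truth.load_le 1 h1mem j
    have hsum := d.truth.sum_sub_eq_slack hmc hTa hs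
    -- Under the truth the objects of `G` already absorb the whole slack. Loads on `G` cannot fall
    -- under the lie, so they are all equal.
    have hle' : ∑ j ∈ G, (load P' T' 1 j - m j) ≤ ∑ j ∈ G, (load P T 1 j - m j) := by
      rw [hsum]
      exact (sum_sub_le_surplus m _ G).trans (d.lie.surplus_le 1 h1mem)
    have heq : ∀ j ∈ G, load P T 1 j = load P' T' 1 j := by
      intro j hj
      have h2 := (Finset.sum_eq_sum_iff_of_le fun j hj => sub_le_sub_right (hmono j hj)
        (m j : ℝ)).1 (le_antisymm (Finset.sum_le_sum fun j hj => sub_le_sub_right (hmono j hj)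
        (m j : ℝ)) hle') j hj
      linarith
    set H := G.filter fun j => T j < T' j with hH
    have h2 : ∑ j ∈ H, eaten (P i₀) T 1 j = ∑ j ∈ H, load P T 1 j :=
      Finset.sum_congr rfl fun j hj => by
        obtain ⟨hj1, hj2⟩ := Finset.mem_filter.1 hj
        exact (d.load_eq_eaten ha ((hGmem j).1 hj1) hj2 (heq j hj1).ge).symm
    have h3 : ∑ j ∈ G with ¬ T j < T' j, load P T 1 j = ∑ j ∈ G with ¬ T j < T' j, (c j : ℝ) :=
      Finset.sum_congr rfl fun j hj => by
        obtain ⟨hj1, hj2⟩ := Finset.mem_filter.1 hj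
        rw [heq j hj1, hcapped j hj1 hj2]
    have h4 := Finset.sum_filter_add_sum_filter_not G (fun j => T j < T' j) (load P T 1)
    rw [Finset.sum_sub_distrib, slack] at hsum
    -- The load of `G` is slack plus minimums; removing the capped objects, at integer capacity,
    -- leaves the load of `H`, all eaten by the manipulator.
    refine d.not_integer (H := H) (fun j hj => (hGmem j).1 (Finset.mem_filter.1 hj).1)
      (by simp [hH, hGmem, d.longer])
      ((Fintype.card N : ℤ) - ∑ j, (m j : ℤ) + ∑ j ∈ G, (m j : ℤ) -
        ∑ j ∈ G with ¬ T j < T' j, (c j : ℤ)) ?_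
    push_cast
    linarith

end Deviation

/-- If a misreport of agent `i₀` yields a lottery that dominates the truthful one, the two
lotteries are equal. -/
theorem IsSchedule.eaten_eq_of_FOSD (h : IsSchedule c m P T) (h' : IsSchedule c m P' T')
    (hmc : ∀ j, m j ≤ c j) (hothers : ∀ i ≠ i₀, P' i = P i)
    (hdom : FOSD (P i₀) (eaten (P' i₀) T' 1) (eaten (P i₀) T 1)) (j : O) :
    eaten (P i₀) T 1 j = eaten (P' i₀) T' 1 j := by
  classical
  let D : Set ℝ := {t | t ∈ Set.Ico (0 : ℝ) 1 ∧ ∃ j, Eats (P i₀) T t j ∧ ¬ Eats (P' i₀) T' t j}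
  have hsame : ∀ t ∈ Set.Ico (0 : ℝ) 1, t ∉ D → ∀ j,
      Eats (P i₀) T t j ↔ Eats (P' i₀) T' t j := by
    intro t ht hD j
    have h1 : ∀ j, Eats (P i₀) T t j → Eats (P' i₀) T' t j := by
      intro j hj
      by_contra hcon
      exact hD ⟨ht, j, hj, hcon⟩
    refine ⟨h1 j, fun hj => ?_⟩
    obtain ⟨k, hk⟩ := h.exists_eats t ht i₀
    exact hj.unique (h1 k hk) ▸ hk
  have hcoin : ∀ τ ≤ 1, (∀ t ∈ D, τ ≤ t) → (∀ t ≤ τ, ∀ k, t < T k ↔ t < T' k) ∧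
      ∀ i j, eaten (P i) T τ j = eaten (P' i) T' τ j := by
    intro τ hτ hD
    refine h.coincide h' hτ fun t h0 ht hav i j => ?_
    by_cases hi : i = i₀
    · subst hi
      exact hsame t ⟨h0, ht.trans_le hτ⟩ (fun hcon => (hD t hcon).not_gt ht) j
    · rw [hothers i hi]
      exact Eats.congr hav j
  rcases D.eq_empty_or_nonempty with hD | hD
  · exact (hcoin 1 le_rfl (by simp [hD])).2 i₀ j
  exfalso
  have hDb : BddBelow D := ⟨0, fun t ht => ht.1.1⟩
  obtain ⟨t₀, ht₀⟩ := hD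
  set τ := sInf D with hτdef
  have hτle : ∀ t ∈ D, τ ≤ t := fun t ht => csInf_le hDb ht
  have hτ0 : 0 ≤ τ := le_csInf ⟨t₀, ht₀⟩ fun t ht => ht.1.1
  have hτ1 : τ < 1 := (hτle t₀ ht₀).trans_lt ht₀.1.2
  obtain ⟨hav, heaten⟩ := hcoin τ hτ1.le hτle
  obtain ⟨a, haeats⟩ := h.exists_eats τ ⟨hτ0, hτ1⟩ i₀
  -- If both reports led to `a` at `τ`, both would keep eating `a` until one of its exhaustion
  -- times, so no difference could occur near the infimum `τ`.
  have hanot : ¬ Eats (P' i₀) T' τ a := by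
    intro hcon
    obtain ⟨t, ht, htlt⟩ := exists_lt_of_csInf_lt ⟨t₀, ht₀⟩ (lt_min haeats.1 hcon.1)
    obtain ⟨k, hk, hk'⟩ := ht.2
    obtain ⟨h1, h2⟩ := lt_min_iff.1 htlt
    have h3 : Eats (P i₀) T t a := ⟨h1, fun l hl => (haeats.2 l hl).trans (hτle t ht)⟩
    have h4 : Eats (P' i₀) T' t a := ⟨h2, fun l hl => (hcon.2 l hl).trans (hτle t ht)⟩
    exact hk' (hk.unique h3 ▸ h4)
  -- Everything truly preferred to `a` is exhausted by `τ` in both schedules, so those final amounts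
  -- agree and dominance passes to `a` itself.
  have hkey : eaten (P i₀) T 1 a ≤ eaten (P' i₀) T' 1 a := by
    refine hdom.le_of_eq_above fun k hk => ?_
    have h1 : T k ≤ τ := haeats.2 k hk
    have h2 : T' k ≤ τ := not_lt.1 fun hlt => h1.not_gt ((hav τ le_rfl k).2 hlt)
    rw [eaten_eq_of_le (h'.le_one k) h2, eaten_eq_of_le (h.le_one k) h1, heaten]
  have hstart : τ < start (P' i₀) T' a := by
    by_contra! hcon
    exact hanot ((eats_iff hτ0).2 ⟨hcon, (hav τ le_rfl a).1 haeats.1⟩)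
  have hstart' : τ ≤ start (P i₀) T a := by
    by_contra! hcon
    have h1 : 0 < eaten (P i₀) T τ a :=
      eaten_pos_iff.2 ⟨hcon.trans haeats.1, hcon⟩
    rw [heaten] at h1
    exact (eaten_pos_iff.1 h1).2.not_gt hstart
  have hstart'' : start (P i₀) T a ≤ τ := ((eats_iff hτ0).1 haeats).1
  have hlonger : T a < T' a := by
    have h1 : eaten (P i₀) T 1 a = T a - start (P i₀) T a := by
      rw [eaten, min_eq_left (h.le_one a), max_eq_right]
      linarith [haeats.1]
    have h2 := haeats.1
    rw [h1, eaten, min_eq_left (h'.le_one a)] at hkey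
    rcases le_max_iff.1 hkey with h3 | h3 <;> linarith
  have d : Deviation c m P P' T T' i₀ a τ :=
    { truth := h, lie := h', others := hothers, nonneg := hτ0, eats := haeats
      longer := hlonger
      before := fun t h0 ht j =>
        (hsame t ⟨h0, ht.trans hτ1⟩ (fun hcon => (hτle t hcon).not_gt ht) j).1 }
  exact (d.eaten_lt hmc).not_ge hkey

end Manipulation

end MinProbSerial

/-! ### Assembly -/

theorem theorem1 {N O : Type*} [Fintype N] [DecidableEq N] [Fintype O] [DecidableEq O]
    (c m : O → ℕ) (hc : ∀ j, 0 < c j) (hmc : ∀ j, m j ≤ c j)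
    (hcap : Fintype.card N ≤ ∑ j, c j) (hmin : ∑ j, m j ≤ Fintype.card N) :
    (∃! f : (N → MinProbSerial.Ranking O) → N → O → ℝ, MinProbSerial.IsMPS c m f) ∧
    ∀ f : (N → MinProbSerial.Ranking O) → N → O → ℝ, MinProbSerial.IsMPS c m f →
      MinProbSerial.IsMechanism c m f ∧
      MinProbSerial.SDEfficient c m f ∧
      MinProbSerial.Anonymous f ∧
      MinProbSerial.EnvyFree f ∧
      MinProbSerial.WeakStrategyproof f := by
  choose run hrun using MinProbSerial.exists_isRun (N := N) hmc hcap hmin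
  refine ⟨⟨fun P => run P 1, fun P => ⟨run P, hrun P, rfl⟩, fun f hf => ?_⟩, fun f hf => ?_⟩
  · funext P
    obtain ⟨μ, hμ, h1⟩ := hf P
    exact h1.symm.trans (hμ.unique (hrun P))
  · have hfin : ∀ P, run P 1 = f P := fun P => by
      obtain ⟨μ, hμ, h1⟩ := hf P
      exact ((hrun P).unique hμ).trans h1
    refine ⟨fun P => ?_, ?_, fun P π => ?_, fun P i i' => ?_, fun P i R' hdom => ?_⟩
    · rw [← hfin]
      exact MinProbSerial.feasible_subset_implementable hmc hcap (hrun P).mem_feasible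
    · rintro P ⟨ν, hν, hdom, i, -, hne⟩
      obtain ⟨T, hT, hμ⟩ := (hrun P).exists_isSchedule
      have hfT : ∀ i, f P i = MinProbSerial.eaten (P i) T 1 := fun i => by
        funext j
        rw [← hfin, hμ 1 (by simp)]
      simp only [hfT] at hdom hne
      exact hne (funext fun j =>
        hT.eq_of_FOSD hmc (MinProbSerial.implementable_subset_feasible hν) hdom i j)
    · rw [← hfin, ← hfin]
      exact (hrun _).unique ((hrun P).comp_perm π)
    · rw [← hfin]
      exact (hrun P).fosd i i'
    · obtain ⟨T, hT, hμ⟩ := (hrun P).exists_isSchedule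
      obtain ⟨T', hT', hμ'⟩ := (hrun (Function.update P i R')).exists_isSchedule
      have hfT : f P i = MinProbSerial.eaten (P i) T 1 := by
        funext j
        rw [← hfin, hμ 1 (by simp)]
      have hfT' : f (Function.update P i R') i =
          MinProbSerial.eaten (Function.update P i R' i) T' 1 := by
        funext j
        rw [← hfin, hμ' 1 (by simp)]
      rw [hfT, hfT'] at hdom ⊢
      funext j
      exact (hT.eaten_eq_of_FOSD hT' hmc (fun k hk => Function.update_of_ne hk _ _) hdom j).symm
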